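/- An MV-algebra is an algebra $(N,\oplus,\otimes,\neg,0,1)$ such that, for all $a,b,c\in N$: $a\oplus b=b\oplus a$; $a\oplus(b\oplus c)=(a\oplus b)\oplus c$; $a\oplus 0=a$; $a\oplus 1=1$; $\neg\neg a=a$; $\neg 0=1$; $\neg(\neg a\oplus b)\oplus b=\neg(\neg b\oplus a)\oplus a$; $a\otimes b=\neg(\neg a\oplus\neg b)$. It is ordered by $a\le b$ iff $a\vee b=b$, where $a\vee b=\neg(\neg a\oplus b)\oplus b$; it is complete if it is a complete lattice in this order, and nontrivial if $0\ne 1$. Homomorphisms and subalgebras are those for the signature $(\oplus,\otimes,\neg,0,1)$. The real interval $I=[0,1]$ is an MV-algebra under $x\oplus y=\min\{x+y,1\}$, $x\otimes y=\max\{x+y-1,0\}$, $\neg x=1-x$. Write $0a=0$, $(k+1)a=a\oplus ka$; $a$ has finite order if $ka=1$ for some $k\ge 1$, and $a$ is complemented (Boolean) if $\neg a\vee a=1$. An ideal of $N$ is a subset containing $0$, closed under $\oplus$ and downward closed; it is proper if it is not $N$. A proper ideal is maximal if it is not properly contained in a proper ideal; a proper ideal $J$ is prime if, for all ideals $J_1,J_2$,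 $J=J_1\cap J_2$ implies $J=J_1$ or $J=J_2$. $\mathrm{Rad}\,J$ is the intersection of all maximal ideals containing $J$ (which is $N$ if there are none). $N$ is simple if $\{0\}$ is its only proper ideal, semisimple if $\mathrm{Rad}\,\{0\}=\{0\}$, and hyperarchimedean if $\mathrm{Rad}\,J=J$ for every ideal $J$. $N$ is a subdirect product of a (possibly empty) family $(S_i)$ of MV-algebras if there is an injective homomorphism $N\to\prod_i S_i$ whose composition with each projection is onto. Theorem. Let $N$ be an MV-algebra. (1) If $N$ is nontrivial, the following are equivalent: (a) $N$ is simple; (b) every nonzero element of $N$ has finite order; (c) $N$ is isomorphic to a subalgebra of $I$. (2) The following are equivalent: (d) $N$ is hyperarchimedean; (e) the prime ideals and the maximal ideals of $N$ coincide; (f) for every $a\in N$ there exists $n\ge 1$ such that $na$ is complemented. (3) The following are equivalent: (g) $N$ is semisimple; (h) $N$ is a subdirect product of subalgebras of $I$; (j) $N$ is isomorphic to a subalgebra of a complete MV-algebra. (4) (a) implies (d), and (d) implies (g). Neither converse holds: there is a nontrivial hyperarchimedean MV-algebra that is not simple, and there is a nontrivial semisimple MV-algebra that is not hyperarchimedean.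 (5) If $N$ is nontrivial and totally ordered, then all the conditions (a)-(j) are equivalent. -/

import Mathlib

universe u v

/-- An MV-algebra `(N, ⊕, ⊗, ¬, 0, 1)`, in the Mangani-Mundici axiomatization. -/
class MVAlgebra (N : Type u) extends Zero N, One N where
  oplus : N → N → N
  otimes : N → N → N
  neg : N → N
  oplus_comm : ∀ a b, oplus a b = oplus b a
  oplus_assoc : ∀ a b c, oplus a (oplus b c) = oplus (oplus a b) c
  oplus_zero : ∀ a, oplus a 0 = a
  oplus_one : ∀ a, oplus a 1 = 1
  neg_neg : ∀ a, neg (neg a) = a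
  neg_zero : neg 0 = 1
  lukasiewicz : ∀ a b, oplus (neg (oplus (neg a) b)) b = oplus (neg (oplus (neg b) a)) a
  otimes_eq : ∀ a b, otimes a b = neg (oplus (neg a) (neg b))

namespace MVAlgebra

section Basic

variable {N : Type u} [MVAlgebra N]

/-- `a ∨ b = ¬(¬a ⊕ b) ⊕ b`. -/
def vee (a b : N) : N := oplus (neg (oplus (neg a) b)) b

/-- The natural order: `a ≤ b` iff `a ∨ b = b`. -/
def le (a b : N) : Prop := vee a b = b

/-- The multiple `k a = a ⊕ ⋯ ⊕ a` (`k` summands), with `0 a = 0`. -/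
def multiple : ℕ → N → N
  | 0, _ => 0
  | k + 1, a => oplus a (multiple k a)

/-- `a` has finite order: `k a = 1` for some positive integer `k`. -/
def HasFiniteOrder (a : N) : Prop := ∃ k : ℕ, 1 ≤ k ∧ multiple k a = 1

/-- `a` is complemented (Boolean): `¬a ∨ a = 1`. -/
def IsComplemented (a : N) : Prop := vee (neg a) a = 1

/-- Ideals: subsets containing `0`, closed under `⊕` and downward closed. -/
structure IsIdeal (J : Set N) : Prop where
  zero_mem : (0 : N) ∈ J
  oplus_mem : ∀ a b, a ∈ J → b ∈ J → oplus a b ∈ J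
  mem_of_le : ∀ a b, le a b → b ∈ J → a ∈ J

/-- Proper ideals. -/
def IsProperIdeal (J : Set N) : Prop := IsIdeal J ∧ J ≠ Set.univ

/-- Maximal ideals: proper ideals not properly contained in any proper ideal. -/
def IsMaximalIdeal (J : Set N) : Prop :=
  IsProperIdeal J ∧ ∀ K : Set N, IsProperIdeal K → J ⊆ K → J = K

/-- Prime ideals: proper ideals that are meet-irreducible among ideals. -/
def IsPrimeIdeal (J : Set N) : Prop :=
  IsProperIdeal J ∧ ∀ J₁ J₂ : Set N, IsIdeal J₁ → IsIdeal J₂ → J = J₁ ∩ J₂ → J = J₁ ∨ J = J₂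

/-- `Rad J`, the intersection of all maximal ideals extending `J` (all of `N` if there are none). -/
def Rad (J : Set N) : Set N := {a | ∀ K : Set N, IsMaximalIdeal K → J ⊆ K → a ∈ K}

end Basic

section Homomorphisms

/-- Homomorphisms of MV-algebras. -/
structure Hom (N : Type u) (M : Type v) [MVAlgebra N] [MVAlgebra M] where
  toFun : N → M
  map_oplus : ∀ a b, toFun (oplus a b) = oplus (toFun a) (toFun b)
  map_otimes : ∀ a b, toFun (otimes a b) = otimes (toFun a) (toFun b)
  map_neg : ∀ a, toFun (neg a) = neg (toFun a)
  map_zero : toFun 0 = 0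
  map_one : toFun 1 = 1

/-- `N` and `M` are isomorphic MV-algebras. -/
def Isomorphic (N : Type u) (M : Type v) [MVAlgebra N] [MVAlgebra M] : Prop :=
  ∃ f : Hom N M, Function.Bijective f.toFun

/-- Subalgebras of an MV-algebra. -/
structure Subalg (M : Type u) [MVAlgebra M] where
  carrier : Set M
  oplus_mem : ∀ a b, a ∈ carrier → b ∈ carrier → oplus a b ∈ carrier
  otimes_mem : ∀ a b, a ∈ carrier → b ∈ carrier → otimes a b ∈ carrier
  neg_mem : ∀ a, a ∈ carrier → neg a ∈ carrier
  zero_mem : (0 : M) ∈ carrier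
  one_mem : (1 : M) ∈ carrier

end Homomorphisms

/-- A subalgebra is an MV-algebra under the restricted operations. -/
instance instSubalg {M : Type u} [MVAlgebra M] (S : Subalg M) : MVAlgebra S.carrier where
  zero := ⟨0, S.zero_mem⟩
  one := ⟨1, S.one_mem⟩
  oplus a b := ⟨oplus a.1 b.1, S.oplus_mem _ _ a.2 b.2⟩
  otimes a b := ⟨otimes a.1 b.1, S.otimes_mem _ _ a.2 b.2⟩
  neg a := ⟨neg a.1, S.neg_mem _ a.2⟩
  oplus_comm a b := Subtype.ext (oplus_comm a.1 b.1)
  oplus_assoc a b c := Subtype.ext (oplus_assoc a.1 b.1 c.1)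
  oplus_zero a := Subtype.ext (oplus_zero a.1)
  oplus_one a := Subtype.ext (oplus_one a.1)
  neg_neg a := Subtype.ext (neg_neg a.1)
  neg_zero := Subtype.ext neg_zero
  lukasiewicz a b := Subtype.ext (lukasiewicz a.1 b.1)
  otimes_eq a b := Subtype.ext (otimes_eq a.1 b.1)

/-- The direct product of a family of MV-algebras, with componentwise operations. -/
instance instPi {ι : Type u} {A : ι → Type v} [∀ i, MVAlgebra (A i)] :
    MVAlgebra (∀ i, A i) where
  zero := fun _ => 0
  one := fun _ => 1
  oplus f g := fun i => oplus (f i) (g i)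
  otimes f g := fun i => otimes (f i) (g i)
  neg f := fun i => neg (f i)
  oplus_comm f g := funext fun i => oplus_comm (f i) (g i)
  oplus_assoc f g h := funext fun i => oplus_assoc (f i) (g i) (h i)
  oplus_zero f := funext fun i => oplus_zero (f i)
  oplus_one f := funext fun i => oplus_one (f i)
  neg_neg f := funext fun i => neg_neg (f i)
  neg_zero := funext fun _ => neg_zero
  lukasiewicz f g := funext fun i => lukasiewicz (f i) (g i)
  otimes_eq f g := funext fun i => otimes_eq (f i) (g i)

/-- The standard MV-algebra on the real unit interval `[0, 1]`. -/
noncomputable instance instUnitInterval : MVAlgebra unitInterval where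
  zero := 0
  one := 1
  oplus a b := ⟨min ((a : ℝ) + b) 1, le_min (add_nonneg a.2.1 b.2.1) zero_le_one, min_le_right _ _⟩
  otimes a b := ⟨max ((a : ℝ) + b - 1) 0, le_max_right _ _,
    max_le (by linarith [a.2.2, b.2.2]) zero_le_one⟩
  neg a := ⟨1 - (a : ℝ), by linarith [a.2.2], by linarith [a.2.1]⟩
  oplus_comm a b := by
    apply Subtype.ext
    simp only [add_comm]
  oplus_assoc a b c := by
    apply Subtype.ext
    have := a.2.1
    have := c.2.1
    simp only
    rcases min_cases ((a : ℝ) + b) 1 with h | h <;>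
    rcases min_cases ((b : ℝ) + c) 1 with h' | h' <;>
    rw [h.1, h'.1] <;> grind
  oplus_zero a := by
    apply Subtype.ext
    change min ((a : ℝ) + 0) 1 = a
    rw [add_zero, min_eq_left a.2.2]
  oplus_one a := by
    apply Subtype.ext
    change min ((a : ℝ) + 1) 1 = 1
    exact min_eq_right (by linarith [a.2.1])
  neg_neg a := by
    apply Subtype.ext
    simp
  neg_zero := by
    apply Subtype.ext
    change (1 : ℝ) - 0 = 1
    norm_num
  lukasiewicz a b := by
    apply Subtype.ext
    have := a.2
    have := b.2
    simp only [Set.mem_Icc] at *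
    grind
  otimes_eq a b := by
    apply Subtype.ext
    simp only
    grind

section Conditions

variable (N : Type u) [MVAlgebra N]

/-- `N` is totally ordered by its natural order. -/
def IsTotallyOrdered : Prop := ∀ a b : N, le a b ∨ le b a

/-- `N` is complete: every subset has a least upper bound and a greatest lower bound
in the natural order. -/
def IsCompleteLattice : Prop :=
  ∀ S : Set N,
    (∃ s : N, (∀ a ∈ S, le a s) ∧ ∀ b : N, (∀ a ∈ S, le a b) → le s b) ∧
    (∃ s : N, (∀ a ∈ S, le s a) ∧ ∀ b : N, (∀ a ∈ S, le b a) → le b s)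

/-- `N` is simple: `{0}` is its only proper ideal. -/
def IsSimple : Prop := ∀ J : Set N, IsProperIdeal J ↔ J = {0}

/-- Every nonzero element of `N` has finite order. -/
def AllFiniteOrder : Prop := ∀ a : N, a ≠ 0 → HasFiniteOrder a

/-- `N` is (isomorphic to) a subalgebra of `[0, 1]`. -/
def IsSubalgebraOfUnitInterval : Prop := ∃ S : Subalg unitInterval, Isomorphic N S.carrier

/-- `N` is hyperarchimedean: `Rad J = J` for every ideal `J`. -/
def IsHyperarchimedean : Prop := ∀ J : Set N, IsIdeal J → Rad J = J

/-- The prime ideals and the maximal ideals of `N` coincide. -/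
def PrimeEqMaximal : Prop := ∀ J : Set N, IsPrimeIdeal J ↔ IsMaximalIdeal J

/-- Every element of `N` has a (positive) multiple that is complemented. -/
def HasComplementedMultiples : Prop := ∀ a : N, ∃ n : ℕ, 1 ≤ n ∧ IsComplemented (multiple n a)

/-- `N` is semisimple: `Rad {0} = {0}`. -/
def IsSemisimple : Prop := Rad ({0} : Set N) = {0}

/-- `N` is a subdirect product of subalgebras of `[0, 1]`: it embeds in a direct product of such
algebras (possibly with empty index set) so that each coordinate projection is onto. -/
def IsSubdirectProduct : Prop :=
  ∃ (ι : Type u) (S : ι → Subalg unitInterval) (f : Hom N (∀ i, (S i).carrier)),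
    Function.Injective f.toFun ∧ ∀ i, Function.Surjective fun a => f.toFun a i

/-- `N` is (isomorphic to) a subalgebra of a complete MV-algebra. -/
def IsSubalgebraOfComplete : Prop :=
  ∃ (M : Type u) (_ : MVAlgebra M),
    IsCompleteLattice M ∧ ∃ S : Subalg M, Isomorphic N S.carrier

end Conditions

end MVAlgebra

-- The arithmetic rests on the truncated difference `a ⊖ b`, residuated to `⊕`, and on prelinearity,
-- `(a ⊖ b) ∧ (b ⊖ a) = 0` (`ominus_wedge_ominus`). Prelinearity makes the ideals above a prime a
-- chain; Zorn's lemma supplies enough primes.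
--
-- The core is the embedding into [0, 1]. If all nonzero elements have finite order, the algebra is
-- a chain. A nontrivial chain is the unit interval of Chang's ordered group, whose elements are an
-- integer plus a fraction from the chain, added with carry. Finite orders make this group
-- archimedean, and Hölder's theorem puts it inside ℝ. Applied to quotients, this makes every
-- maximal ideal the kernel of a map to [0, 1], so a semisimple algebra embeds in a cube, which is
-- complete. Conversely, every `a` in `Rad {0}` satisfies `n a ≤ ¬a` for all `n`; homomorphisms
-- preserve this property, and in a complete algebra it forces `a = 0`.
--
-- For hyperarchimedean algebras, complemented multiples make primes maximal, and ideals are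
-- intersections of primes; an element without such a multiple yields a prime that is not maximal.
-- In a semisimple chain, a maximal ideal omitting `a` forces `a` to have finite order. The square
-- and the countable power of [0, 1] separate the three classes.

universe w

namespace MVAlgebra

local infixl:65 " ⊕ₘ " => oplus
local infixl:70 " ⊗ₘ " => otimes
local prefix:max "∼ₘ" => neg
local infix:50 " ≼ " => le

/-! ### Truncated difference, order and lattice arithmetic -/

section Difference

variable {N : Type u} [MVAlgebra N]

/-- Truncated difference `a ⊗ ¬b`. -/
def ominus (a b : N) : N := ∼ₘ(∼ₘa ⊕ₘ b)

/-- `a ∧ b = a ⊖ (a ⊖ b)`. -/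
def wedge (a b : N) : N := ominus a (ominus a b)

end Difference

local infixl:65 " ⊖ₘ " => ominus
local infixl:69 " ⊓ₘ " => wedge

section Arithmetic

variable {N : Type u} [MVAlgebra N]

instance : Std.Commutative (oplus : N → N → N) := ⟨oplus_comm⟩

instance : Std.Associative (oplus : N → N → N) := ⟨fun a b c => (oplus_assoc a b c).symm⟩

theorem zero_oplus (a : N) : 0 ⊕ₘ a = a := by rw [oplus_comm, oplus_zero]

theorem one_oplus (a : N) : 1 ⊕ₘ a = 1 := by rw [oplus_comm, oplus_one]

theorem neg_one : ∼ₘ(1 : N) = 0 := by rw [← neg_zero, neg_neg]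

theorem neg_injective {a b : N} (h : ∼ₘa = ∼ₘb) : a = b := by
  rw [← neg_neg a, h, neg_neg]

theorem neg_oplus_self (a : N) : ∼ₘa ⊕ₘ a = 1 := by
  have h := lukasiewicz a 1
  rw [oplus_one, neg_one, zero_oplus] at h
  exact h.symm

theorem oplus_neg_self (a : N) : a ⊕ₘ ∼ₘa = 1 := by rw [oplus_comm, neg_oplus_self]

theorem le_iff {a b : N} : a ≼ b ↔ ∼ₘa ⊕ₘ b = 1 := by
  constructor
  · intro h
    have h' : ∼ₘ(∼ₘa ⊕ₘ b) ⊕ₘ b = b := h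
    calc ∼ₘa ⊕ₘ b = ∼ₘa ⊕ₘ (∼ₘ(∼ₘa ⊕ₘ b) ⊕ₘ b) := by rw [h']
      _ = (∼ₘa ⊕ₘ b) ⊕ₘ ∼ₘ(∼ₘa ⊕ₘ b) := by ac_rfl
      _ = 1 := oplus_neg_self _
  · intro h
    change ∼ₘ(∼ₘa ⊕ₘ b) ⊕ₘ b = b
    rw [h, neg_one, zero_oplus]

theorem le_refl (a : N) : a ≼ a := le_iff.2 (neg_oplus_self a)

theorem le_antisymm {a b : N} (h : a ≼ b) (h' : b ≼ a) : a = b := by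
  have h1 : ∼ₘ(∼ₘa ⊕ₘ b) ⊕ₘ b = b := h
  have h2 : ∼ₘ(∼ₘb ⊕ₘ a) ⊕ₘ a = a := h'
  rw [← h1, lukasiewicz, h2]

theorem ominus_oplus_of_le {a b : N} (h : b ≼ a) : (a ⊖ₘ b) ⊕ₘ b = a := by
  have h1 : ∼ₘ(∼ₘb ⊕ₘ a) ⊕ₘ a = a := h
  rw [ominus, lukasiewicz, h1]

theorem le_trans {a b c : N} (h : a ≼ b) (h' : b ≼ c) : a ≼ c := by
  rw [le_iff] at h ⊢
  rw [← ominus_oplus_of_le h', oplus_comm _ b, oplus_assoc, h, one_oplus]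

theorem le_oplus_right (a b : N) : a ≼ a ⊕ₘ b := by
  rw [le_iff, oplus_assoc, neg_oplus_self, one_oplus]

theorem le_oplus_left (a b : N) : a ≼ b ⊕ₘ a := by
  rw [oplus_comm]; exact le_oplus_right a b

theorem zero_le (a : N) : 0 ≼ a := by rw [le_iff, neg_zero, one_oplus]

theorem le_one (a : N) : a ≼ 1 := by rw [le_iff, oplus_one]

theorem eq_zero_of_le {a : N} (h : a ≼ 0) : a = 0 := le_antisymm h (zero_le a)

theorem eq_one_of_le {a : N} (h : 1 ≼ a) : a = 1 := le_antisymm (le_one a) h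

theorem neg_le_neg_iff {a b : N} : ∼ₘa ≼ ∼ₘb ↔ b ≼ a := by
  rw [le_iff, le_iff, neg_neg, oplus_comm]

theorem neg_le_iff {a b : N} : ∼ₘa ≼ b ↔ a ⊕ₘ b = 1 := by rw [le_iff, neg_neg]

theorem le_neg_comm {a b : N} : a ≼ ∼ₘb ↔ b ≼ ∼ₘa := by
  rw [le_iff, le_iff, oplus_comm]

/-- Residuation: by associativity, both sides say `¬a ⊕ b ⊕ c = 1`. -/
theorem ominus_le_iff {a b c : N} : a ⊖ₘ b ≼ c ↔ a ≼ b ⊕ₘ c := by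
  rw [ominus, neg_le_iff, le_iff, oplus_assoc]

theorem le_oplus_ominus (a b : N) : a ≼ b ⊕ₘ (a ⊖ₘ b) := ominus_le_iff.1 (le_refl _)

theorem ominus_le (a b : N) : a ⊖ₘ b ≼ a := ominus_le_iff.2 (le_oplus_left a b)

theorem ominus_le_neg (a b : N) : a ⊖ₘ b ≼ ∼ₘb := by
  rw [ominus, neg_le_neg_iff]; exact le_oplus_left _ _

theorem oplus_le_oplus_left (c : N) {a b : N} (h : a ≼ b) : c ⊕ₘ a ≼ c ⊕ₘ b := by
  have e : c ⊕ₘ b = (c ⊕ₘ a) ⊕ₘ (b ⊖ₘ a) := by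
    nth_rw 1 [← ominus_oplus_of_le h]
    ac_rfl
  rw [e]
  exact le_oplus_right _ _

theorem oplus_le_oplus {a b c d : N} (h : a ≼ b) (h' : c ≼ d) : a ⊕ₘ c ≼ b ⊕ₘ d := by
  refine le_trans (oplus_le_oplus_left a h') ?_
  rw [oplus_comm a, oplus_comm b]
  exact oplus_le_oplus_left d h

theorem ominus_self (a : N) : a ⊖ₘ a = 0 := by rw [ominus, neg_oplus_self, neg_one]

theorem ominus_eq_zero_iff {a b : N} : a ⊖ₘ b = 0 ↔ a ≼ b := by
  rw [le_iff, ominus, ← neg_one]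
  exact ⟨neg_injective, fun h => by rw [h]⟩

theorem zero_ominus (a : N) : 0 ⊖ₘ a = 0 := ominus_eq_zero_iff.2 (zero_le a)

/-- The Łukasiewicz axiom for `¬a` and `¬b`, negated. -/
theorem wedge_comm (a b : N) : a ⊓ₘ b = b ⊓ₘ a := by
  have h := lukasiewicz ∼ₘa ∼ₘb
  rw [neg_neg, neg_neg] at h
  rw [wedge, wedge, ominus, ominus, ominus, ominus, oplus_comm ∼ₘa, oplus_comm ∼ₘb, oplus_comm ∼ₘa,
    oplus_comm ∼ₘb, h]

theorem wedge_le_left (a b : N) : a ⊓ₘ b ≼ a := ominus_le _ _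

theorem wedge_le_right (a b : N) : a ⊓ₘ b ≼ b := by
  rw [wedge_comm]; exact wedge_le_left b a

theorem ominus_le_ominus {a b c d : N} (h : a ≼ b) (h' : d ≼ c) : a ⊖ₘ c ≼ b ⊖ₘ d := by
  rw [ominus_le_iff]
  exact le_trans h (le_trans (le_oplus_ominus b d) (oplus_le_oplus h' (le_refl _)))

theorem wedge_eq_left {a b : N} (h : a ≼ b) : a ⊓ₘ b = a := by
  rw [wedge, ominus_eq_zero_iff.2 h, ominus, oplus_zero, neg_neg]

theorem le_wedge {a b c : N} (h : c ≼ a) (h' : c ≼ b) : c ≼ a ⊓ₘ b := by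
  have h1 : c ⊓ₘ b ≼ a ⊓ₘ b := by
    rw [wedge_comm, wedge_comm a]
    exact ominus_le_ominus (le_refl _) (ominus_le_ominus (le_refl _) h)
  rwa [wedge_eq_left h'] at h1

/-- Residuate twice: removing `b` from the left side leaves at most `a ∧ c`, so removing `a ∧ c`
leaves at most `a` and at most `b`. -/
theorem wedge_oplus_le (a b c : N) : a ⊓ₘ (b ⊕ₘ c) ≼ (a ⊓ₘ b) ⊕ₘ (a ⊓ₘ c) := by
  have h1 : (a ⊓ₘ (b ⊕ₘ c)) ⊖ₘ b ≼ a ⊓ₘ c :=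
    le_wedge (le_trans (ominus_le _ _) (wedge_le_left _ _))
      (ominus_le_iff.2 (wedge_le_right _ _))
  rw [oplus_comm (a ⊓ₘ b), ← ominus_le_iff]
  refine le_wedge (le_trans (ominus_le _ _) (wedge_le_left _ _)) ?_
  rw [ominus_le_iff, oplus_comm (a ⊓ₘ c) b]
  exact ominus_le_iff.1 h1

/-- The bound means that `d ⊕ m` is not truncated. Formally, the left side unfolds to `¬m ∧ d`. -/
theorem oplus_ominus_cancel {d m : N} (h : d ≼ ∼ₘm) : (d ⊕ₘ m) ⊖ₘ m = d := by
  have h1 : ∼ₘm ⊓ₘ d = d := by rw [wedge_comm]; exact wedge_eq_left h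
  rw [wedge, ominus, ominus, neg_neg] at h1
  rw [ominus]
  nth_rw 2 [← h1]
  congr 1
  ac_rfl

/-- Put `m = a ∧ b`; then `a = (a ⊖ b) ⊕ m` and `b = (b ⊖ a) ⊕ m`. If `d` is the meet of the two
differences, `d ⊕ m` is below `a` and `b`, hence below `m`, and cancelling `m` gives `d = 0`. -/
theorem ominus_wedge_ominus (a b : N) : (a ⊖ₘ b) ⊓ₘ (b ⊖ₘ a) = 0 := by
  have key : ∀ x y : N, x ⊖ₘ (x ⊓ₘ y) = x ⊖ₘ y := fun x y => by
    change x ⊓ₘ (x ⊖ₘ y) = x ⊖ₘ y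
    rw [wedge_comm]
    exact wedge_eq_left (ominus_le x y)
  have h1 : (a ⊖ₘ b) ⊕ₘ (a ⊓ₘ b) = a := by
    rw [← key]; exact ominus_oplus_of_le (wedge_le_left a b)
  have h2 : (b ⊖ₘ a) ⊕ₘ (a ⊓ₘ b) = b := by
    rw [← key, wedge_comm b a]; exact ominus_oplus_of_le (wedge_le_right a b)
  have hd : (a ⊖ₘ b) ⊓ₘ (b ⊖ₘ a) ≼ ∼ₘ(a ⊓ₘ b) := by
    refine le_trans (wedge_le_left _ _) ?_
    rw [← key]
    exact ominus_le_neg _ _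
  rw [← oplus_ominus_cancel hd, ominus_eq_zero_iff]
  have h3 := oplus_le_oplus (wedge_le_left (a ⊖ₘ b) (b ⊖ₘ a)) (le_refl (a ⊓ₘ b))
  have h4 := oplus_le_oplus (wedge_le_right (a ⊖ₘ b) (b ⊖ₘ a)) (le_refl (a ⊓ₘ b))
  rw [h1] at h3
  rw [h2] at h4
  exact le_wedge h3 h4

theorem multiple_one (a : N) : multiple 1 a = a := oplus_zero a

theorem multiple_add (m n : ℕ) (a : N) : multiple (m + n) a = multiple m a ⊕ₘ multiple n a := by
  induction m with
  | zero => rw [Nat.zero_add]; exact (zero_oplus _).symm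
  | succ m ih =>
    rw [Nat.succ_add]
    change a ⊕ₘ multiple (m + n) a = (a ⊕ₘ multiple m a) ⊕ₘ multiple n a
    rw [ih, oplus_assoc]

theorem multiple_le_multiple (n : ℕ) {a b : N} (h : a ≼ b) : multiple n a ≼ multiple n b := by
  induction n with
  | zero => exact le_refl _
  | succ n ih => exact oplus_le_oplus h ih

theorem multiple_mono {m n : ℕ} (h : m ≤ n) (a : N) : multiple m a ≼ multiple n a := by
  obtain ⟨k, rfl⟩ := Nat.exists_eq_add_of_le h
  rw [multiple_add]
  exact le_oplus_right _ _

theorem le_multiple {n : ℕ} (h : 1 ≤ n) (a : N) : a ≼ multiple n a := by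
  have := multiple_mono h a
  rwa [multiple_one] at this

theorem multiple_zero_right (n : ℕ) : multiple n (0 : N) = 0 := by
  induction n with
  | zero => rfl
  | succ n ih => exact (zero_oplus _).trans ih

theorem wedge_multiple_le (n : ℕ) (a b : N) : a ⊓ₘ multiple n b ≼ multiple n (a ⊓ₘ b) := by
  induction n with
  | zero => exact wedge_le_right _ _
  | succ n ih =>
    exact le_trans (wedge_oplus_le _ _ _) (oplus_le_oplus (le_refl _) ih)

theorem isComplemented_iff {a : N} : IsComplemented a ↔ a ⊓ₘ ∼ₘa = 0 := by
  rw [IsComplemented, vee, neg_neg, wedge_comm, wedge, ominus, ominus, neg_neg, oplus_comm]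
  rw [← neg_one]
  exact ⟨fun h => by rw [h], neg_injective⟩

theorem zero_ne_one [Nontrivial N] : (0 : N) ≠ 1 := by
  intro h
  obtain ⟨a, b, hab⟩ := exists_pair_ne N
  have key : ∀ x : N, x = 0 := fun x => eq_zero_of_le (h ▸ le_one x)
  exact hab ((key a).trans (key b).symm)

theorem otimes_eq_ominus (a b : N) : otimes a b = a ⊖ₘ ∼ₘb := otimes_eq a b

end Arithmetic

/-! ### Ideals, prime ideals, maximal ideals -/

section Ideals

variable {N : Type u} [MVAlgebra N]

theorem isIdeal_singleton_zero : IsIdeal ({0} : Set N) where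
  zero_mem := rfl
  oplus_mem := by
    rintro a b rfl rfl
    exact oplus_zero _
  mem_of_le := by
    rintro a b h rfl
    exact eq_zero_of_le h

theorem IsIdeal.multiple_mem {J : Set N} (hJ : IsIdeal J) {a : N} (ha : a ∈ J) (n : ℕ) :
    multiple n a ∈ J := by
  induction n with
  | zero => exact hJ.zero_mem
  | succ n ih => exact hJ.oplus_mem _ _ ha ih

theorem IsIdeal.mem_of_ominus_mem {J : Set N} (hJ : IsIdeal J) {a b : N} (h : a ⊖ₘ b ∈ J)
    (hb : b ∈ J) : a ∈ J :=
  hJ.mem_of_le _ _ (le_oplus_ominus a b) (hJ.oplus_mem _ _ hb h)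

theorem IsIdeal.eq_univ_iff {J : Set N} (hJ : IsIdeal J) : J = Set.univ ↔ (1 : N) ∈ J :=
  ⟨fun h => h ▸ Set.mem_univ _,
    fun h => Set.eq_univ_of_forall fun a => hJ.mem_of_le a 1 (le_one a) h⟩

theorem isProperIdeal_iff {J : Set N} : IsProperIdeal J ↔ IsIdeal J ∧ (1 : N) ∉ J :=
  and_congr_right fun hJ => not_congr hJ.eq_univ_iff

/-- The ideal generated by an ideal `J` and an element `a`. -/
def adjoin (J : Set N) (a : N) : Set N := {x | ∃ j ∈ J, ∃ n : ℕ, x ≼ j ⊕ₘ multiple n a}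

theorem IsIdeal.adjoin {J : Set N} (hJ : IsIdeal J) (a : N) : IsIdeal (adjoin J a) where
  zero_mem := ⟨0, hJ.zero_mem, 0, zero_le _⟩
  oplus_mem := by
    rintro x y ⟨i, hi, m, hx⟩ ⟨j, hj, n, hy⟩
    refine ⟨i ⊕ₘ j, hJ.oplus_mem _ _ hi hj, m + n, ?_⟩
    have e : (i ⊕ₘ j) ⊕ₘ multiple (m + n) a
        = (i ⊕ₘ multiple m a) ⊕ₘ (j ⊕ₘ multiple n a) := by
      rw [multiple_add]
      ac_rfl
    rw [e]
    exact oplus_le_oplus hx hy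
  mem_of_le := by
    rintro x y h ⟨j, hj, n, hy⟩
    exact ⟨j, hj, n, le_trans h hy⟩

theorem subset_adjoin (J : Set N) (a : N) : J ⊆ adjoin J a :=
  fun x hx => ⟨x, hx, 0, le_oplus_right _ _⟩

theorem IsIdeal.mem_adjoin {J : Set N} (hJ : IsIdeal J) (a : N) : a ∈ MVAlgebra.adjoin J a :=
  ⟨0, hJ.zero_mem, 1, by rw [multiple_one]; exact le_oplus_left _ _⟩

/-- Zorn's lemma for an arbitrary set `F` to avoid: `F = {1}` gives maximal ideals, a down-directed
`F` gives primes. -/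
theorem exists_maximal_ideal_disjoint {J F : Set N} (hJ : IsIdeal J) (hF : ∀ x ∈ F, x ∉ J) :
    ∃ P : Set N, J ⊆ P ∧ IsIdeal P ∧ (∀ x ∈ F, x ∉ P) ∧
      ∀ K : Set N, IsIdeal K → (∀ x ∈ F, x ∉ K) → P ⊆ K → P = K := by
  obtain ⟨P, hJP, hP⟩ := zorn_subset_nonempty {K : Set N | IsIdeal K ∧ ∀ x ∈ F, x ∉ K} (by
    intro c hc hchain hne
    refine ⟨⋃₀ c, ⟨⟨?_, ?_, ?_⟩, ?_⟩, fun s hs => Set.subset_sUnion_of_mem hs⟩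
    · obtain ⟨s, hs⟩ := hne
      exact ⟨s, hs, (hc hs).1.zero_mem⟩
    · rintro a b ⟨s, hs, ha⟩ ⟨t, ht, hb⟩
      rcases hchain.total hs ht with h | h
      · exact ⟨t, ht, (hc ht).1.oplus_mem _ _ (h ha) hb⟩
      · exact ⟨s, hs, (hc hs).1.oplus_mem _ _ ha (h hb)⟩
    · rintro a b h ⟨s, hs, hb⟩
      exact ⟨s, hs, (hc hs).1.mem_of_le _ _ h hb⟩
    · rintro x hx ⟨s, hs, hxs⟩
      exact (hc hs).2 x hx hxs) J ⟨hJ, hF⟩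
  exact ⟨P, hJP, hP.prop.1, hP.prop.2, fun K hK hKF hPK => hP.eq_of_subset ⟨hK, hKF⟩ hPK⟩

theorem exists_maximalIdeal {J : Set N} (hJ : IsProperIdeal J) :
    ∃ M : Set N, IsMaximalIdeal M ∧ J ⊆ M := by
  rw [isProperIdeal_iff] at hJ
  obtain ⟨M, hJM, hM, h1, hmax⟩ := exists_maximal_ideal_disjoint (F := {1}) hJ.1 (by
    rintro x rfl; exact hJ.2)
  refine ⟨M, ⟨isProperIdeal_iff.2 ⟨hM, h1 1 rfl⟩, fun K hK => hmax K hK.1 ?_⟩, hJM⟩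
  rintro x rfl
  exact (isProperIdeal_iff.1 hK).2

/-- Every ideal avoiding a nonempty down-directed set extends to a prime ideal avoiding it. -/
theorem exists_primeIdeal_disjoint {J F : Set N} (hJ : IsIdeal J) (hF : ∀ x ∈ F, x ∉ J)
    (hne : F.Nonempty) (hdir : ∀ x ∈ F, ∀ y ∈ F, ∃ z ∈ F, z ≼ x ∧ z ≼ y) :
    ∃ P : Set N, IsPrimeIdeal P ∧ J ⊆ P ∧ ∀ x ∈ F, x ∉ P := by
  obtain ⟨P, hJP, hP, hPF, hmax⟩ := exists_maximal_ideal_disjoint hJ hF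
  refine ⟨P, ⟨⟨hP, ?_⟩, ?_⟩, hJP, hPF⟩
  · obtain ⟨x, hx⟩ := hne
    exact fun h => hPF x hx (h ▸ Set.mem_univ x)
  · intro J₁ J₂ h₁ h₂ h
    by_contra! hcon
    have key : ∀ K : Set N, IsIdeal K → P ⊆ K → P ≠ K → ∃ x ∈ F, x ∈ K := by
      intro K hK hPK hne
      by_contra! hK'
      exact hne (hmax K hK hK' hPK)
    obtain ⟨x, hxF, hx⟩ := key J₁ h₁ (h ▸ Set.inter_subset_left) hcon.1
    obtain ⟨y, hyF, hy⟩ := key J₂ h₂ (h ▸ Set.inter_subset_right) hcon.2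
    -- A common lower bound in `F` lies in both larger ideals, hence in their intersection `P`,
    -- which avoids `F`.
    obtain ⟨z, hzF, hzx, hzy⟩ := hdir x hxF y hyF
    apply hPF z hzF
    rw [h]
    exact ⟨h₁.mem_of_le _ _ hzx hx, h₂.mem_of_le _ _ hzy hy⟩

theorem exists_primeIdeal_notMem {J : Set N} (hJ : IsIdeal J) {a : N} (ha : a ∉ J) :
    ∃ P : Set N, IsPrimeIdeal P ∧ J ⊆ P ∧ a ∉ P := by
  obtain ⟨P, hP, hJP, h⟩ := exists_primeIdeal_disjoint (F := {a}) hJ (by rintro x rfl; exact ha)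
    ⟨a, rfl⟩ (by rintro x rfl y rfl; exact ⟨_, rfl, le_refl _, le_refl _⟩)
  exact ⟨P, hP, hJP, h a rfl⟩

theorem IsMaximalIdeal.isPrimeIdeal {M : Set N} (hM : IsMaximalIdeal M) : IsPrimeIdeal M := by
  refine ⟨hM.1, fun J₁ J₂ h₁ h₂ h => ?_⟩
  by_cases hu : J₁ = Set.univ
  · right
    rwa [hu, Set.univ_inter] at h
  · exact Or.inl (hM.2 J₁ ⟨h₁, hu⟩ (h ▸ Set.inter_subset_left))

/-- Adjoining `a` and adjoining `b` gives two ideals that meet exactly in `P`, because `m a ∧ n b ≤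
n (m (a ∧ b))`. Meet-irreducibility then makes one of them equal to `P`. -/
theorem IsPrimeIdeal.mem_or_mem {P : Set N} (hP : IsPrimeIdeal P) {a b : N}
    (h : a ⊓ₘ b ∈ P) : a ∈ P ∨ b ∈ P := by
  have hI : IsIdeal P := hP.1.1
  have key : P = adjoin P a ∩ adjoin P b := by
    refine Set.Subset.antisymm (Set.subset_inter (subset_adjoin _ _) (subset_adjoin _ _)) ?_
    rintro x ⟨⟨i, hi, m, hx⟩, j, hj, n, hy⟩
    have hij : i ⊕ₘ j ∈ P := hI.oplus_mem _ _ hi hj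
    refine hI.mem_of_ominus_mem ?_ hij
    refine hI.mem_of_le _ (multiple n (multiple m (b ⊓ₘ a))) ?_ ?_
    · refine le_trans (le_wedge (a := multiple m a) (b := multiple n b) ?_ ?_) ?_
      · rw [ominus_le_iff]
        exact le_trans hx (oplus_le_oplus (le_oplus_right _ _) (le_refl _))
      · rw [ominus_le_iff]
        exact le_trans hy (oplus_le_oplus (le_oplus_left _ _) (le_refl _))
      · refine le_trans (wedge_multiple_le _ _ _) (multiple_le_multiple _ ?_)
        rw [wedge_comm]
        exact wedge_multiple_le _ _ _
    · rw [wedge_comm]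
      exact hI.multiple_mem (hI.multiple_mem h m) n
  rcases hP.2 _ _ (hI.adjoin a) (hI.adjoin b) key with h | h
  · left
    rw [h]
    exact hI.mem_adjoin a
  · right
    rw [h]
    exact hI.mem_adjoin b

/-- Adjoining `a` to `M` must produce `1 = j ⊕ n a` with `j ∈ M`, and then `¬(n a) ≤ j`. -/
theorem IsMaximalIdeal.exists_neg_multiple_mem {M : Set N} (hM : IsMaximalIdeal M) {a : N}
    (ha : a ∉ M) : ∃ n : ℕ, ∼ₘ(multiple n a) ∈ M := by
  have hI : IsIdeal M := hM.1.1
  by_cases h1 : (1 : N) ∈ adjoin M a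
  · obtain ⟨j, hj, n, h⟩ := h1
    refine ⟨n, hI.mem_of_le _ j ?_ hj⟩
    rw [neg_le_iff, oplus_comm]
    exact eq_one_of_le h
  · have := hM.2 _ (isProperIdeal_iff.2 ⟨hI.adjoin a, h1⟩) (subset_adjoin _ _)
    rw [this] at ha
    exact absurd (hI.mem_adjoin a) ha

/-- The ideals that contain a given prime ideal form a chain. -/
theorem IsPrimeIdeal.subset_or_subset {P I J : Set N} (hP : IsPrimeIdeal P) (hI : IsIdeal I)
    (hJ : IsIdeal J) (hPI : P ⊆ I) (hPJ : P ⊆ J) : I ⊆ J ∨ J ⊆ I := by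
  by_contra! h
  obtain ⟨⟨a, haI, haJ⟩, b, hbJ, hbI⟩ := And.imp Set.not_subset.1 Set.not_subset.1 h
  -- By prelinearity `P` contains one of the two differences, which puts `a` in `J` or `b` in `I`.
  have h0 : (a ⊖ₘ b) ⊓ₘ (b ⊖ₘ a) ∈ P := by
    rw [ominus_wedge_ominus]
    exact hP.1.1.zero_mem
  rcases hP.mem_or_mem h0 with h | h
  · exact haJ (hJ.mem_of_ominus_mem (hPJ h) hbJ)
  · exact hbI (hI.mem_of_ominus_mem (hPI h) haI)

theorem subset_rad (J : Set N) : J ⊆ Rad J := fun _ ha _ _ hJK => hJK ha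

end Ideals

/-! ### Hyperarchimedean algebras -/

section Hyperarchimedean

variable {N : Type u} [MVAlgebra N]

/-- Ideals above a prime `P` form a chain, so only one maximal ideal contains `P`. It is therefore
`Rad P`, which equals `P`. -/
theorem IsHyperarchimedean.primeEqMaximal (h : IsHyperarchimedean N) : PrimeEqMaximal N := by
  refine fun P => ⟨fun hP => ?_, IsMaximalIdeal.isPrimeIdeal⟩
  obtain ⟨M, hM, hPM⟩ := exists_maximalIdeal hP.1
  suffices hMP : M ⊆ P from Set.Subset.antisymm hPM hMP ▸ hM
  rw [← h P hP.1.1]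
  intro a ha K hK hPK
  rcases hP.subset_or_subset hM.1.1 hK.1.1 hPM hPK with h | h
  · exact h ha
  · rwa [hK.2 M hM.1 h]

/-- The point is that `a` and its annihilator generate `1`. Otherwise some maximal `M` contains
both. The elements above some `a ∧ b` with `b ∉ M` then form a filter missing `0`, and a prime
avoiding this filter lies in `M` but omits `a`, so it is not maximal. -/
theorem PrimeEqMaximal.hasComplementedMultiples (h : PrimeEqMaximal N) :
    HasComplementedMultiples N := by
  intro a
  have hperp : IsIdeal {b : N | a ⊓ₘ b = 0} := by
    refine ⟨eq_zero_of_le (wedge_le_right _ _), fun b c hb hc => ?_, fun b c hbc hc => ?_⟩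
    · have h1 := wedge_oplus_le a b c
      rw [show a ⊓ₘ b = 0 from hb, show a ⊓ₘ c = 0 from hc, oplus_zero] at h1
      exact eq_zero_of_le h1
    · apply eq_zero_of_le
      rw [← show a ⊓ₘ c = 0 from hc]
      exact le_wedge (wedge_le_left _ _) (le_trans (wedge_le_right _ _) hbc)
  have h1 : (1 : N) ∈ adjoin {b : N | a ⊓ₘ b = 0} a := by
    by_contra h1
    obtain ⟨M, hM, hsub⟩ := exists_maximalIdeal (isProperIdeal_iff.2 ⟨hperp.adjoin a, h1⟩)
    have haM : a ∈ M := hsub (hperp.mem_adjoin a)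
    obtain ⟨P, hP, -, hPF⟩ := exists_primeIdeal_disjoint
      (F := {x : N | ∃ b, b ∉ M ∧ a ⊓ₘ b ≼ x}) isIdeal_singleton_zero (by
        rintro x ⟨b, hb, hx⟩ rfl
        exact hb (hsub (subset_adjoin _ _ (eq_zero_of_le hx))))
      ⟨a, 1, (isProperIdeal_iff.1 hM.1).2, wedge_le_left _ _⟩ (by
        rintro x ⟨b, hb, hx⟩ y ⟨c, hc, hy⟩
        refine ⟨a ⊓ₘ (b ⊓ₘ c), ⟨_, fun hbc => ?_, le_refl _⟩, le_trans (le_wedge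
          (wedge_le_left _ _) (le_trans (wedge_le_right _ _) (wedge_le_left _ _))) hx,
          le_trans (le_wedge
          (wedge_le_left _ _) (le_trans (wedge_le_right _ _) (wedge_le_right _ _))) hy⟩
        rcases hM.isPrimeIdeal.mem_or_mem hbc with h | h
        exacts [hb h, hc h])
    have hPM : P ⊆ M := by
      intro b hbP
      by_contra hb
      exact hPF b ⟨b, hb, wedge_le_right _ _⟩ hbP
    have hPeq : P = M := ((h P).1 hP).2 M hM.1 hPM
    rw [← hPeq] at haM
    exact hPF a ⟨1, (isProperIdeal_iff.1 hM.1).2, wedge_le_left _ _⟩ haM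
  obtain ⟨b, hb, n, hn⟩ := h1
  -- The exponent `n` may be `0`, so it is raised by one. Then `¬((n + 1) a) ≤ b` is disjoint from
  -- `a`, hence from all its multiples.
  have hn1 := le_trans hn (oplus_le_oplus (le_refl b) (multiple_mono (Nat.le_succ n) a))
  refine ⟨n + 1, Nat.le_add_left 1 n, isComplemented_iff.2 (eq_zero_of_le ?_)⟩
  have h2 : ∼ₘ(multiple (n + 1) a) ≼ b := by
    rw [neg_le_iff, oplus_comm]
    exact eq_one_of_le hn1
  refine le_trans (le_wedge (le_trans (wedge_le_right _ _) h2) (wedge_le_left _ _)) ?_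
  refine le_trans (wedge_multiple_le _ _ _) ?_
  rw [wedge_comm, show a ⊓ₘ b = 0 from hb, multiple_zero_right]
  exact le_refl _

/-- A prime separates `J` from any element outside it, so it suffices that a prime `P` be maximal.
If `b` lies in a proper `K ⊇ P` and `n b` is complemented, `P` contains `n b` or `¬(n b)`; the
latter would put `1` in `K`. -/
theorem HasComplementedMultiples.isHyperarchimedean (h : HasComplementedMultiples N) :
    IsHyperarchimedean N := by
  intro J hJ
  refine Set.Subset.antisymm (fun a ha => ?_) (subset_rad J)
  by_contra haJ
  obtain ⟨P, hP, hJP, haP⟩ := exists_primeIdeal_notMem hJ haJ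
  refine haP (ha P ⟨hP.1, fun K hK hPK => Set.Subset.antisymm hPK fun b hbK => ?_⟩ hJP)
  obtain ⟨n, hn, hc⟩ := h b
  have h0 : multiple n b ⊓ₘ ∼ₘ(multiple n b) ∈ P := by
    rw [isComplemented_iff.1 hc]
    exact hP.1.1.zero_mem
  rcases hP.mem_or_mem h0 with h | h
  · exact hP.1.1.mem_of_le _ _ (le_multiple hn b) h
  · have := hK.1.oplus_mem _ _ (hPK h) (hK.1.multiple_mem hbK n)
    rw [neg_oplus_self] at this
    exact absurd this (isProperIdeal_iff.1 hK).2

end Hyperarchimedean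

/-! ### The radical and infinitesimals -/

section Radical

variable {N : Type u} [MVAlgebra N]

/-- If this fails, a prime omits `n a ⊖ ¬a` and so contains `¬a ⊖ n a`. A maximal ideal above it
contains `a`, hence `n a`, hence `¬a`, hence `1`. -/
theorem multiple_le_neg_of_mem_rad {a : N} (ha : a ∈ Rad ({0} : Set N)) (n : ℕ) :
    multiple n a ≼ ∼ₘa := by
  by_contra h
  obtain ⟨P, hP, -, hnot⟩ := exists_primeIdeal_notMem (a := multiple n a ⊖ₘ ∼ₘa)
    isIdeal_singleton_zero (fun h0 => h (ominus_eq_zero_iff.1 h0))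
  obtain ⟨M, hM, hPM⟩ := exists_maximalIdeal hP.1
  have haM : a ∈ M := ha M hM (Set.singleton_subset_iff.2 hM.1.1.zero_mem)
  have h0 : (multiple n a ⊖ₘ ∼ₘa) ⊓ₘ (∼ₘa ⊖ₘ multiple n a) ∈ P := by
    rw [ominus_wedge_ominus]
    exact hP.1.1.zero_mem
  have h1 := hM.1.1.mem_of_ominus_mem (hPM ((hP.mem_or_mem h0).resolve_left hnot))
    (hM.1.1.multiple_mem haM n)
  have h2 := hM.1.1.oplus_mem _ _ h1 haM
  rw [neg_oplus_self] at h2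
  exact (isProperIdeal_iff.1 hM.1).2 h2

theorem isSemisimple_of_archimedean (h : ∀ a : N, (∀ n, multiple n a ≼ ∼ₘa) → a = 0) :
    IsSemisimple N :=
  Set.Subset.antisymm (fun a ha => h a (multiple_le_neg_of_mem_rad ha)) (subset_rad _)

/-- Complete MV-algebras have no nonzero infinitesimals. -/
theorem IsCompleteLattice.eq_zero_of_forall_multiple_le (hN : IsCompleteLattice N) {a : N}
    (ha : ∀ n, multiple n a ≼ ∼ₘa) : a = 0 := by
  obtain ⟨s, hub, hlub⟩ := (hN (Set.range fun n => multiple n a)).1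
  -- Since `n a ≤ ¬a`, subtracting `a` from `(n + 1) a` returns `n a`; thus `s ⊖ a` again bounds all
  -- multiples. Then `s ∧ a = s ⊖ s = 0`, although `a ≤ s`.
  have hle : s ≼ s ⊖ₘ a := by
    apply hlub
    rintro _ ⟨n, rfl⟩
    have h1 : multiple (n + 1) a ≼ s := hub _ ⟨n + 1, rfl⟩
    have h2 : (multiple n a ⊕ₘ a) ⊖ₘ a = multiple n a := oplus_ominus_cancel (ha n)
    change multiple n a ≼ _
    rw [← h2, oplus_comm]
    exact ominus_le_ominus h1 (le_refl a)
  have hs : s ⊖ₘ a = s := le_antisymm (ominus_le _ _) hle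
  have has : a ≼ s := hub a ⟨1, multiple_one a⟩
  have h3 : s ⊓ₘ a = 0 := by rw [wedge, hs, ominus_self]
  rwa [wedge_comm, wedge_eq_left has] at h3

end Radical

/-! ### Finite order, simplicity and chains -/

section Simple

variable {N : Type u} [MVAlgebra N]

theorem IsSimple.allFiniteOrder (h : IsSimple N) : AllFiniteOrder N := by
  intro a ha
  have h1 : (1 : N) ∈ adjoin {0} a := by
    by_contra h1
    have h2 := (h _).1 (isProperIdeal_iff.2 ⟨isIdeal_singleton_zero.adjoin a, h1⟩)
    have h3 := isIdeal_singleton_zero.mem_adjoin a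
    rw [h2] at h3
    exact ha h3
  obtain ⟨_, rfl, n, hn⟩ := h1
  refine ⟨n + 1, Nat.le_add_left 1 n, eq_one_of_le (le_trans hn ?_)⟩
  rw [zero_oplus]
  exact multiple_mono (Nat.le_succ n) a

theorem AllFiniteOrder.isSimple (h0 : (0 : N) ≠ 1) (h : AllFiniteOrder N) : IsSimple N := by
  intro J
  constructor
  · intro hJ
    rw [isProperIdeal_iff] at hJ
    refine Set.Subset.antisymm (fun a ha => ?_) (Set.singleton_subset_iff.2 hJ.1.zero_mem)
    by_contra hne
    obtain ⟨k, -, hk⟩ := h a hne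
    exact hJ.2 (hk ▸ hJ.1.multiple_mem ha k)
  · rintro rfl
    exact isProperIdeal_iff.2 ⟨isIdeal_singleton_zero, fun h1 => h0 h1.symm⟩

/-- If `a ⊖ b` is nonzero, some multiple of it is `1`. Being disjoint from `a ⊖ b`, the element `b ⊖
a` is disjoint from that multiple, hence zero. -/
theorem AllFiniteOrder.isTotallyOrdered (h : AllFiniteOrder N) : IsTotallyOrdered N := by
  intro a b
  by_contra! hcon
  have h1 : a ⊖ₘ b ≠ 0 := fun h0 => hcon.1 (ominus_eq_zero_iff.1 h0)
  obtain ⟨k, -, hk⟩ := h _ h1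
  have h2 := wedge_multiple_le k (b ⊖ₘ a) (a ⊖ₘ b)
  rw [wedge_comm (b ⊖ₘ a) (a ⊖ₘ b), ominus_wedge_ominus, multiple_zero_right, hk,
    wedge_eq_left (le_one _)] at h2
  exact hcon.2 (ominus_eq_zero_iff.1 (eq_zero_of_le h2))

theorem IsSimple.isHyperarchimedean (h : IsSimple N) : IsHyperarchimedean N := by
  intro J hJ
  refine Set.Subset.antisymm ?_ (subset_rad J)
  by_cases hu : J = Set.univ
  · rw [hu]
    exact Set.subset_univ _
  · have hJ' : IsProperIdeal J := ⟨hJ, hu⟩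
    refine fun a ha => ha J ⟨hJ', fun K hK _ => ?_⟩ subset_rfl
    rw [(h J).1 hJ', (h K).1 hK]

theorem IsHyperarchimedean.isSemisimple (h : IsHyperarchimedean N) : IsSemisimple N :=
  h _ isIdeal_singleton_zero

/-- Some maximal `M` omits `a`, so it contains some `¬(n a)`. Then `n a ≤ ¬(n a)` would put `1` in
`M`; by totality `¬(n a) ≤ n a`, that is, `2n a = 1`. -/
theorem IsSemisimple.allFiniteOrder (hN : IsTotallyOrdered N) (h : IsSemisimple N) :
    AllFiniteOrder N := by
  intro a ha
  have h1 : a ∉ Rad ({0} : Set N) := by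
    rw [show Rad ({0} : Set N) = {0} from h]
    exact ha
  simp only [Rad, Set.mem_ofPred_eq, not_forall] at h1
  obtain ⟨M, hM, -, haM⟩ := h1
  obtain ⟨n, hn⟩ := hM.exists_neg_multiple_mem haM
  have hI : IsIdeal M := hM.1.1
  have hle : ∼ₘ(multiple n a) ≼ multiple n a := by
    refine (hN _ _).resolve_right fun h2 => ?_
    have h3 := hI.oplus_mem _ _ hn (hI.mem_of_le _ _ h2 hn)
    rw [neg_oplus_self] at h3
    exact (isProperIdeal_iff.1 hM.1).2 h3
  rw [neg_le_iff, ← multiple_add] at hle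
  exact ⟨n + n + 1, Nat.le_add_left _ _,
    eq_one_of_le (hle ▸ multiple_mono (Nat.le_succ _) a)⟩

end Simple

/-! ### Quotients and homomorphisms -/

section Quotients

variable {N : Type u} [MVAlgebra N]

theorem ominus_zero (a : N) : a ⊖ₘ 0 = a := by rw [ominus, oplus_zero, neg_neg]

theorem neg_ominus_neg (a b : N) : ∼ₘa ⊖ₘ ∼ₘb = b ⊖ₘ a := by
  rw [ominus, ominus, neg_neg, oplus_comm]

/-- The reason that congruence modulo an ideal respects `⊕`. -/
theorem oplus_ominus_oplus_le (a b c d : N) :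
    (a ⊕ₘ c) ⊖ₘ (b ⊕ₘ d) ≼ (a ⊖ₘ b) ⊕ₘ (c ⊖ₘ d) := by
  rw [ominus_le_iff]
  have h := oplus_le_oplus (le_oplus_ominus a b) (le_oplus_ominus c d)
  have e : (b ⊕ₘ (a ⊖ₘ b)) ⊕ₘ (d ⊕ₘ (c ⊖ₘ d)) = (b ⊕ₘ d) ⊕ₘ ((a ⊖ₘ b) ⊕ₘ (c ⊖ₘ d)) := by
    ac_rfl
  rwa [e] at h

/-- The congruence determined by an ideal. -/
def idealSetoid {J : Set N} (hJ : IsIdeal J) : Setoid N where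
  r a b := a ⊖ₘ b ∈ J ∧ b ⊖ₘ a ∈ J
  iseqv := by
    have key : ∀ a b c : N, a ⊖ₘ b ∈ J → b ⊖ₘ c ∈ J → a ⊖ₘ c ∈ J := by
      intro a b c h h'
      refine hJ.mem_of_le _ _ ?_ (hJ.oplus_mem _ _ h' h)
      rw [ominus_le_iff, oplus_assoc]
      exact le_trans (le_oplus_ominus a b)
        (oplus_le_oplus (le_oplus_ominus b c) (le_refl _))
    refine ⟨fun a => ?_, fun h => ⟨h.2, h.1⟩,
      fun h h' => ⟨key _ _ _ h.1 h'.1, key _ _ _ h'.2 h.2⟩⟩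
    rw [ominus_self]
    exact ⟨hJ.zero_mem, hJ.zero_mem⟩

/-- The quotient of an MV-algebra by an ideal. -/
def IdealQuotient {J : Set N} (hJ : IsIdeal J) : Type u := Quotient (idealSetoid hJ)

/-- The class of an element modulo an ideal. -/
def IdealQuotient.mk {J : Set N} (hJ : IsIdeal J) (a : N) : IdealQuotient hJ :=
  Quotient.mk (idealSetoid hJ) a

/-- Addition on the quotient by an ideal. -/
def IdealQuotient.add {J : Set N} (hJ : IsIdeal J) :
    IdealQuotient hJ → IdealQuotient hJ → IdealQuotient hJ :=
  Quotient.map₂ oplus fun a b h c d h' =>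
    ⟨hJ.mem_of_le _ _ (oplus_ominus_oplus_le a b c d) (hJ.oplus_mem _ _ h.1 h'.1),
      hJ.mem_of_le _ _ (oplus_ominus_oplus_le b a d c) (hJ.oplus_mem _ _ h.2 h'.2)⟩

/-- Negation on the quotient by an ideal. -/
def IdealQuotient.compl {J : Set N} (hJ : IsIdeal J) : IdealQuotient hJ → IdealQuotient hJ :=
  Quotient.map neg fun a b h => by
    change ∼ₘa ⊖ₘ ∼ₘb ∈ J ∧ ∼ₘb ⊖ₘ ∼ₘa ∈ J
    rw [neg_ominus_neg, neg_ominus_neg]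
    exact ⟨h.2, h.1⟩

theorem IdealQuotient.ind {J : Set N} {hJ : IsIdeal J} {p : IdealQuotient hJ → Prop}
    (h : ∀ a, p (mk hJ a)) (q : IdealQuotient hJ) : p q := Quotient.ind h q

instance {J : Set N} (hJ : IsIdeal J) : MVAlgebra (IdealQuotient hJ) where
  zero := .mk hJ 0
  one := .mk hJ 1
  oplus := .add hJ
  otimes a b := .compl hJ (.add hJ (.compl hJ a) (.compl hJ b))
  neg := .compl hJ
  oplus_comm a b := by
    induction a using IdealQuotient.ind
    induction b using IdealQuotient.ind
    exact congrArg (IdealQuotient.mk hJ) (oplus_comm _ _)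
  oplus_assoc a b c := by
    induction a using IdealQuotient.ind
    induction b using IdealQuotient.ind
    induction c using IdealQuotient.ind
    exact congrArg (IdealQuotient.mk hJ) (oplus_assoc _ _ _)
  oplus_zero a := by
    induction a using IdealQuotient.ind
    exact congrArg (IdealQuotient.mk hJ) (oplus_zero _)
  oplus_one a := by
    induction a using IdealQuotient.ind
    exact congrArg (IdealQuotient.mk hJ) (oplus_one _)
  neg_neg a := by
    induction a using IdealQuotient.ind
    exact congrArg (IdealQuotient.mk hJ) (neg_neg _)
  neg_zero := congrArg (IdealQuotient.mk hJ) neg_zero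
  lukasiewicz a b := by
    induction a using IdealQuotient.ind
    induction b using IdealQuotient.ind
    exact congrArg (IdealQuotient.mk hJ) (lukasiewicz _ _)
  otimes_eq _ _ := rfl

theorem IdealQuotient.mk_eq_zero_iff {J : Set N} (hJ : IsIdeal J) {a : N} :
    mk hJ a = 0 ↔ a ∈ J := by
  have h : mk hJ a = 0 ↔ (a ⊖ₘ 0 ∈ J ∧ 0 ⊖ₘ a ∈ J) :=
    Quotient.eq (r := idealSetoid hJ) (x := a) (y := 0)
  rw [h, ominus_zero, zero_ominus]
  exact and_iff_left hJ.zero_mem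

theorem IdealQuotient.multiple_mk {J : Set N} (hJ : IsIdeal J) (n : ℕ) (a : N) :
    multiple n (mk hJ a) = mk hJ (multiple n a) := by
  induction n with
  | zero => rfl
  | succ n ih =>
    change mk hJ a ⊕ₘ multiple n (mk hJ a) = _
    rw [ih]
    rfl

/-- A map preserving `⊕`, `¬` and `0` is a homomorphism. -/
def Hom.ofOplusNeg {M : Type v} [MVAlgebra M] (f : N → M)
    (hadd : ∀ a b, f (a ⊕ₘ b) = f a ⊕ₘ f b) (hneg : ∀ a, f ∼ₘa = ∼ₘ(f a)) (hzero : f 0 = 0) :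
    Hom N M where
  toFun := f
  map_oplus := hadd
  map_otimes a b := by rw [otimes_eq, otimes_eq, hneg, hadd, hneg, hneg]
  map_neg := hneg
  map_zero := hzero
  map_one := by rw [← neg_zero, hneg, hzero, neg_zero]

/-- Composition of homomorphisms. -/
def Hom.comp {M : Type v} {L : Type w} [MVAlgebra M] [MVAlgebra L] (g : Hom M L) (f : Hom N M) :
    Hom N L :=
  .ofOplusNeg (fun a => g.toFun (f.toFun a)) (fun a b => by rw [f.map_oplus, g.map_oplus])
    (fun a => by rw [f.map_neg, g.map_neg]) (by rw [f.map_zero, g.map_zero])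

/-- The quotient homomorphism. -/
def IdealQuotient.mkHom {J : Set N} (hJ : IsIdeal J) : Hom N (IdealQuotient hJ) :=
  .ofOplusNeg (IdealQuotient.mk hJ) (fun _ _ => rfl) (fun _ => rfl) rfl

theorem Hom.map_ominus {M : Type v} [MVAlgebra M] (f : Hom N M) (a b : N) :
    f.toFun (a ⊖ₘ b) = f.toFun a ⊖ₘ f.toFun b := by
  rw [ominus, ominus, f.map_neg, f.map_oplus, f.map_neg]

theorem Hom.map_multiple {M : Type v} [MVAlgebra M] (f : Hom N M) (n : ℕ) (a : N) :
    f.toFun (multiple n a) = multiple n (f.toFun a) := by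
  induction n with
  | zero => exact f.map_zero
  | succ n ih =>
    change f.toFun (a ⊕ₘ multiple n a) = f.toFun a ⊕ₘ multiple n (f.toFun a)
    rw [f.map_oplus, ih]

theorem Hom.map_le {M : Type v} [MVAlgebra M] (f : Hom N M) {a b : N} (h : a ≼ b) :
    f.toFun a ≼ f.toFun b := by
  rw [← ominus_eq_zero_iff, ← f.map_ominus, ominus_eq_zero_iff.2 h, f.map_zero]

/-- The range of a homomorphism. -/
def Hom.range {M : Type v} [MVAlgebra M] (f : Hom N M) : Subalg M where
  carrier := Set.range f.toFun
  oplus_mem := by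
    rintro _ _ ⟨a, rfl⟩ ⟨b, rfl⟩
    exact ⟨_, f.map_oplus a b⟩
  otimes_mem := by
    rintro _ _ ⟨a, rfl⟩ ⟨b, rfl⟩
    exact ⟨_, f.map_otimes a b⟩
  neg_mem := by
    rintro _ ⟨a, rfl⟩
    exact ⟨_, f.map_neg a⟩
  zero_mem := ⟨0, f.map_zero⟩
  one_mem := ⟨1, f.map_one⟩

theorem Hom.isomorphic_range {M : Type v} [MVAlgebra M] (f : Hom N M)
    (hf : Function.Injective f.toFun) : Isomorphic N f.range.carrier :=
  ⟨.ofOplusNeg (fun a => ⟨f.toFun a, a, rfl⟩) (fun a b => Subtype.ext (f.map_oplus a b))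
    (fun a => Subtype.ext (f.map_neg a)) (Subtype.ext f.map_zero),
    fun _ _ h => hf (Subtype.ext_iff.1 h), by
      rintro ⟨_, a, rfl⟩
      exact ⟨a, rfl⟩⟩

/-- The inclusion of a subalgebra. -/
def Subalg.subtype {M : Type v} [MVAlgebra M] (S : Subalg M) : Hom S.carrier M :=
  .ofOplusNeg Subtype.val (fun _ _ => rfl) (fun _ => rfl) rfl

theorem Isomorphic.exists_injective_hom {M : Type v} [MVAlgebra M] {S : Subalg M}
    (h : Isomorphic N S.carrier) : ∃ f : Hom N M, Function.Injective f.toFun := by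
  obtain ⟨f, hf⟩ := h
  exact ⟨S.subtype.comp f, Subtype.val_injective.comp hf.1⟩

theorem Hom.injective_of_forall_eq_zero {M : Type v} [MVAlgebra M] (f : Hom N M)
    (h : ∀ a, f.toFun a = 0 → a = 0) : Function.Injective f.toFun := by
  intro a b hab
  apply le_antisymm
  · exact ominus_eq_zero_iff.1 (h _ (by rw [f.map_ominus, hab, ominus_self]))
  · exact ominus_eq_zero_iff.1 (h _ (by rw [f.map_ominus, hab, ominus_self]))

theorem IsMaximalIdeal.allFiniteOrder_quotient {M : Set N} (hM : IsMaximalIdeal M) :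
    AllFiniteOrder (IdealQuotient hM.1.1) := by
  intro q hq
  induction q using IdealQuotient.ind with | _ a
  rw [Ne, IdealQuotient.mk_eq_zero_iff] at hq
  obtain ⟨n, hn⟩ := hM.exists_neg_multiple_mem hq
  have h1 : multiple n (IdealQuotient.mk hM.1.1 a) = 1 := by
    apply neg_injective
    rw [neg_one, IdealQuotient.multiple_mk]
    exact (IdealQuotient.mk_eq_zero_iff hM.1.1).2 hn
  exact ⟨n + 1, Nat.le_add_left _ _, eq_one_of_le (h1 ▸ multiple_mono (Nat.le_succ n) _)⟩

theorem IsMaximalIdeal.zero_ne_one_quotient {M : Set N} (hM : IsMaximalIdeal M) :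
    (0 : IdealQuotient hM.1.1) ≠ 1 := fun h =>
  (isProperIdeal_iff.1 hM.1).2 ((IdealQuotient.mk_eq_zero_iff hM.1.1).1 h.symm)

end Quotients

/-! ### Identities behind addition with carry -/

section Carrying

variable {N : Type u} [MVAlgebra N]

theorem otimes_comm (a b : N) : a ⊗ₘ b = b ⊗ₘ a := by rw [otimes_eq, otimes_eq, oplus_comm]

theorem otimes_assoc (a b c : N) : a ⊗ₘ (b ⊗ₘ c) = (a ⊗ₘ b) ⊗ₘ c := by
  simp only [otimes_eq, neg_neg, oplus_assoc]

theorem otimes_le_left (a b : N) : a ⊗ₘ b ≼ a := by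
  rw [otimes_eq_ominus]
  exact ominus_le _ _

theorem otimes_eq_ominus_neg (a b : N) : a ⊗ₘ b = b ⊖ₘ ∼ₘa := by
  rw [otimes_comm, otimes_eq_ominus]

theorem otimes_eq_zero_iff {a b : N} : a ⊗ₘ b = 0 ↔ a ≼ ∼ₘb := by
  rw [otimes_eq_ominus, ominus_eq_zero_iff]

theorem neg_otimes (a b : N) : ∼ₘ(a ⊗ₘ b) = ∼ₘa ⊕ₘ ∼ₘb := by rw [otimes_eq, neg_neg]

theorem neg_oplus (a b : N) : ∼ₘ(a ⊕ₘ b) = ∼ₘa ⊗ₘ ∼ₘb := by rw [otimes_eq, neg_neg, neg_neg]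

theorem ominus_oplus (a b c : N) : a ⊖ₘ (b ⊕ₘ c) = (a ⊖ₘ b) ⊖ₘ c := by
  rw [ominus, ominus, ominus, neg_neg, oplus_assoc]

theorem neg_oplus_oplus_self {x s : N} (h : x ≼ ∼ₘs) : ∼ₘ(s ⊕ₘ x) ⊕ₘ x = ∼ₘs := by
  have := ominus_oplus_of_le h
  rwa [ominus, neg_neg] at this

/-- Here `a ⊗ b` stands for a + b - 1 and `b ⊕ c` for b + c, so both sides stand for a + b + c - 1.
Formally, `b = r ⊕ ¬a`, and `¬a` cancels from the untruncated sum `r ⊕ c ⊕ ¬a`. -/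
theorem otimes_oplus_of_oplus_eq_one {a b c : N} (hab : a ⊕ₘ b = 1) (hbc : b ⊗ₘ c = 0) :
    (a ⊗ₘ b) ⊕ₘ c = a ⊗ₘ (b ⊕ₘ c) := by
  have hle : ∼ₘa ≼ b := neg_le_iff.2 hab
  rw [otimes_eq_ominus_neg, otimes_eq_ominus_neg]
  set r := b ⊖ₘ ∼ₘa with hr
  have hb : r ⊕ₘ ∼ₘa = b := ominus_oplus_of_le hle
  have hrn : r ≼ ∼ₘ∼ₘa := ominus_le_neg _ _
  have hc : c ≼ ∼ₘ(∼ₘa ⊕ₘ r) := by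
    rw [oplus_comm, hb]
    exact le_neg_comm.1 (otimes_eq_zero_iff.1 hbc)
  have h1 : r ⊕ₘ c ≼ ∼ₘ∼ₘa := by
    rw [← neg_oplus_oplus_self hrn, oplus_comm]
    exact oplus_le_oplus hc (le_refl r)
  have h2 := oplus_ominus_cancel h1
  have e : (r ⊕ₘ c) ⊕ₘ ∼ₘa = b ⊕ₘ c := by
    rw [← hb]
    ac_rfl
  rw [e] at h2
  exact h2.symm

/-- Both sides equal `¬s`, where `s` stands for 2 - a - b - c; the vanishing triple product is what
makes this nonnegative. -/
theorem otimes_oplus_eq_oplus_otimes {a b c : N} (hab : a ⊕ₘ b = 1) (hbc : b ⊕ₘ c = 1)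
    (h : (a ⊗ₘ b) ⊗ₘ c = 0) : (a ⊗ₘ b) ⊕ₘ c = a ⊕ₘ (b ⊗ₘ c) := by
  have ha : ∼ₘa ≼ b := neg_le_iff.2 hab
  have hc : ∼ₘc ≼ b := neg_le_iff.2 (by rw [oplus_comm, hbc])
  rw [otimes_eq_ominus_neg a b, otimes_eq_ominus b c]
  rw [otimes_eq_zero_iff, otimes_eq_ominus_neg] at h
  set q := b ⊖ₘ ∼ₘc with hq
  have hqa : q ≼ ∼ₘa := by
    rw [hq, ominus_le_iff, oplus_comm, ← ominus_le_iff]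
    exact h
  have hb : q ⊕ₘ ∼ₘc = b := ominus_oplus_of_le hc
  set s := ∼ₘa ⊖ₘ q with hs
  have has : s ⊕ₘ q = ∼ₘa := ominus_oplus_of_le hqa
  have hsc : s ≼ ∼ₘc := by
    rw [hs, ominus_le_iff, hb]
    exact ha
  have hqc : ∼ₘc ≼ ∼ₘq := le_neg_comm.1 (ominus_le_neg b ∼ₘc)
  have hp : b ⊖ₘ ∼ₘa = ∼ₘc ⊖ₘ s := by
    rw [← has, oplus_comm s, ominus_oplus, ← hb, oplus_comm q, oplus_ominus_cancel hqc]
  have e1 : (∼ₘc ⊖ₘ s) ⊕ₘ c = ∼ₘs := by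
    rw [ominus, neg_neg, oplus_comm c]
    exact neg_oplus_oplus_self (le_neg_comm.1 hsc)
  have e2 : a ⊕ₘ q = ∼ₘs := by
    rw [← neg_neg a, ← has]
    exact neg_oplus_oplus_self (le_neg_comm.1 (ominus_le_neg _ _))
  rw [hp, e1, e2]

theorem oplus_otimes_eq_otimes_oplus {a b c : N} (hab : a ⊗ₘ b = 0) (hbc : b ⊗ₘ c = 0)
    (h : (a ⊕ₘ b) ⊕ₘ c = 1) : (a ⊕ₘ b) ⊗ₘ c = a ⊗ₘ (b ⊕ₘ c) := by
  -- The De Morgan dual of the previous identity.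
  apply neg_injective
  rw [neg_otimes, neg_otimes, neg_oplus, neg_oplus]
  apply otimes_oplus_eq_oplus_otimes
  · rw [← neg_otimes, hab, neg_zero]
  · rw [← neg_otimes, hbc, neg_zero]
  · rw [← neg_oplus, ← neg_oplus, h, neg_one]

end Carrying

/-- Nontrivial totally ordered MV-algebras. -/
class IsMVChain (N : Type u) [MVAlgebra N] : Prop where
  total : IsTotallyOrdered N
  zero_ne_one : (0 : N) ≠ 1

/-! ### Chang's group of a chain and its embedding in ℝ -/

section ChangGroup

variable {N : Type u} [MVAlgebra N]

open Classical in
/-- The carry of the sum of two elements of an MV-chain. -/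
noncomputable def carry (a b : N) : ℤ := if a ⊕ₘ b = 1 then 1 else 0

open Classical in
/-- The sum of two elements of an MV-chain, reduced modulo the unit. -/
noncomputable def remainder (a b : N) : N := if a ⊕ₘ b = 1 then a ⊗ₘ b else a ⊕ₘ b

theorem carry_of_eq {a b : N} (h : a ⊕ₘ b = 1) : carry a b = 1 := if_pos h

theorem carry_of_ne {a b : N} (h : a ⊕ₘ b ≠ 1) : carry a b = 0 := if_neg h

theorem remainder_of_eq {a b : N} (h : a ⊕ₘ b = 1) : remainder a b = a ⊗ₘ b := if_pos h

theorem remainder_of_ne {a b : N} (h : a ⊕ₘ b ≠ 1) : remainder a b = a ⊕ₘ b := if_neg h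

theorem carry_comm (a b : N) : carry a b = carry b a := by rw [carry, carry, oplus_comm]

theorem remainder_comm (a b : N) : remainder a b = remainder b a := by
  rw [remainder, remainder, oplus_comm, otimes_comm]

theorem remainder_ne_one {a b : N} (ha : a ≠ 1) : remainder a b ≠ 1 := by
  by_cases h : a ⊕ₘ b = 1
  · rw [remainder_of_eq h]
    exact fun h1 => ha (eq_one_of_le (h1 ▸ otimes_le_left a b))
  · rwa [remainder_of_ne h]

theorem otimes_eq_zero_of_oplus_ne_one [IsMVChain N] {a b : N} (h : a ⊕ₘ b ≠ 1) :
    a ⊗ₘ b = 0 := by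
  rw [otimes_eq_zero_iff]
  refine (IsMVChain.total _ _).resolve_right fun h' => h ?_
  rwa [neg_le_iff, oplus_comm] at h'

/-- Both bracketings carry exactly once: `(a ⊗ b) ⊕ c = a ⊗ (b ⊕ c) ≤ a`, and `a ≠ 1` excludes a
second carry. -/
theorem carry_remainder_assoc_of_ne [IsMVChain N] {a b c : N} (ha : a ≠ 1) (hab : a ⊕ₘ b = 1)
    (hbc : b ⊕ₘ c ≠ 1) :
    carry a b + carry (remainder a b) c = carry b c + carry a (remainder b c) ∧
      remainder (remainder a b) c = remainder a (remainder b c) := by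
  have h0 := otimes_eq_zero_of_oplus_ne_one hbc
  have h1 := otimes_oplus_of_oplus_eq_one hab h0
  have h2 : a ⊕ₘ (b ⊕ₘ c) = 1 := by rw [oplus_assoc, hab, one_oplus]
  have h3 : (a ⊗ₘ b) ⊕ₘ c ≠ 1 := fun h =>
    ha (eq_one_of_le (h ▸ h1 ▸ otimes_le_left a _))
  rw [remainder_of_eq hab, remainder_of_ne hbc, carry_of_eq hab, carry_of_ne hbc, carry_of_ne h3,
    carry_of_eq h2, remainder_of_ne h3, remainder_of_eq h2]
  exact ⟨rfl, h1⟩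

/-- The cocycle identity for carries and associativity of remainders: together, associativity in
Chang's group. -/
theorem carry_remainder_assoc [IsMVChain N] {a b c : N} (ha : a ≠ 1) (hc : c ≠ 1) :
    carry a b + carry (remainder a b) c = carry b c + carry a (remainder b c) ∧
      remainder (remainder a b) c = remainder a (remainder b c) := by
  by_cases hab : a ⊕ₘ b = 1 <;> by_cases hbc : b ⊕ₘ c = 1
  · rw [remainder_of_eq hab, remainder_of_eq hbc, carry_of_eq hab, carry_of_eq hbc]
    -- If the triple product vanishes, the two second sums coincide; otherwise both of them carry.
    by_cases h0 : (a ⊗ₘ b) ⊗ₘ c = 0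
    · have h1 := otimes_oplus_eq_oplus_otimes hab hbc h0
      by_cases h2 : (a ⊗ₘ b) ⊕ₘ c = 1
      · have h3 := h1 ▸ h2
        rw [carry_of_eq h2, carry_of_eq h3, remainder_of_eq h2, remainder_of_eq h3, otimes_assoc]
        exact ⟨rfl, rfl⟩
      · have h3 := h1 ▸ h2
        rw [carry_of_ne h2, carry_of_ne h3, remainder_of_ne h2, remainder_of_ne h3, h1]
        exact ⟨rfl, rfl⟩
    · have h2 : (a ⊗ₘ b) ⊕ₘ c = 1 := by
        by_contra h
        exact h0 (otimes_eq_zero_of_oplus_ne_one h)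
      have h3 : a ⊕ₘ (b ⊗ₘ c) = 1 := by
        by_contra h
        rw [← otimes_assoc] at h0
        exact h0 (otimes_eq_zero_of_oplus_ne_one h)
      rw [carry_of_eq h2, carry_of_eq h3, remainder_of_eq h2, remainder_of_eq h3, otimes_assoc]
      exact ⟨rfl, rfl⟩
  · exact carry_remainder_assoc_of_ne ha hab hbc
  -- The mirror image of the preceding case, with `a` and `c` exchanged.
  · rw [oplus_comm] at hab hbc
    obtain ⟨h1, h2⟩ := carry_remainder_assoc_of_ne hc hbc hab
    rw [carry_comm c b, remainder_comm c b, carry_comm b a, remainder_comm b a, carry_comm _ a,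
      carry_comm c (remainder a b)] at h1
    rw [remainder_comm c b, remainder_comm b a, remainder_comm _ a,
      remainder_comm c (remainder a b)] at h2
    exact ⟨h1.symm, h2.symm⟩
  · rw [remainder_of_ne hab, remainder_of_ne hbc, carry_of_ne hab, carry_of_ne hbc]
    by_cases h2 : (a ⊕ₘ b) ⊕ₘ c = 1
    · have h3 : a ⊕ₘ (b ⊕ₘ c) = 1 := by rwa [oplus_assoc]
      rw [carry_of_eq h2, carry_of_eq h3, remainder_of_eq h2, remainder_of_eq h3]
      exact ⟨rfl, oplus_otimes_eq_otimes_oplus (otimes_eq_zero_of_oplus_ne_one hab)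
        (otimes_eq_zero_of_oplus_ne_one hbc) h2⟩
    · have h3 : a ⊕ₘ (b ⊕ₘ c) ≠ 1 := by rwa [oplus_assoc]
      rw [carry_of_ne h2, carry_of_ne h3, remainder_of_ne h2, remainder_of_ne h3]
      exact ⟨rfl, (oplus_assoc _ _ _).symm⟩

/-- Chang's totally ordered group of an MV-chain: an element consists of an integral part and of
a fractional part, which is an element of the chain other than `1`. -/
@[ext]
structure ChangGroup (N : Type u) [MVAlgebra N] where
  int : ℤ
  frac : N
  frac_ne_one : frac ≠ 1

namespace ChangGroup

theorem zero_oplus_zero_ne_one [IsMVChain N] : (0 : N) ⊕ₘ 0 ≠ 1 := by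
  rw [oplus_zero]
  exact IsMVChain.zero_ne_one

instance [IsMVChain N] : Zero (ChangGroup N) := ⟨⟨0, 0, IsMVChain.zero_ne_one⟩⟩

instance [IsMVChain N] : One (ChangGroup N) := ⟨⟨1, 0, IsMVChain.zero_ne_one⟩⟩

noncomputable instance : Add (ChangGroup N) :=
  ⟨fun x y => ⟨x.int + y.int + carry x.frac y.frac, remainder x.frac y.frac,
    remainder_ne_one x.frac_ne_one⟩⟩

open Classical in
noncomputable instance [IsMVChain N] : Neg (ChangGroup N) :=
  ⟨fun x => if h : x.frac = 0 then ⟨-x.int, 0, IsMVChain.zero_ne_one⟩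
    -- A nonzero fraction borrows a unit: -(n + a) = (-n - 1) + ¬a. For `a = 0` this would give the
    -- forbidden fraction `1`.
    else ⟨-x.int - 1, ∼ₘ(x.frac), fun h1 => h (by rw [← neg_neg x.frac, h1, neg_one])⟩⟩

theorem int_add (x y : ChangGroup N) : (x + y).int = x.int + y.int + carry x.frac y.frac := rfl

theorem frac_add (x y : ChangGroup N) : (x + y).frac = remainder x.frac y.frac := rfl

noncomputable instance [IsMVChain N] : AddCommGroup (ChangGroup N) where
  add_assoc x y z := by
    obtain ⟨h1, h2⟩ := carry_remainder_assoc (b := y.frac) x.frac_ne_one z.frac_ne_one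
    ext
    · simp only [int_add, frac_add]
      linarith
    · exact h2
  zero_add x := by
    have h : (0 : N) ⊕ₘ x.frac ≠ 1 := by
      rw [zero_oplus]
      exact x.frac_ne_one
    ext
    · change 0 + x.int + carry 0 x.frac = x.int
      rw [carry_of_ne h]
      ring
    · change remainder 0 x.frac = x.frac
      rw [remainder_of_ne h, zero_oplus]
  add_zero x := by
    have h : x.frac ⊕ₘ 0 ≠ 1 := by
      rw [oplus_zero]
      exact x.frac_ne_one
    ext
    · change x.int + 0 + carry x.frac 0 = x.int
      rw [carry_of_ne h]
      ring
    · change remainder x.frac 0 = x.frac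
      rw [remainder_of_ne h, oplus_zero]
  add_comm x y := by
    ext
    · rw [int_add, int_add, carry_comm, add_comm x.int]
    · exact remainder_comm _ _
  nsmul := nsmulRec
  zsmul := zsmulRec
  neg_add_cancel x := by
    by_cases h : x.frac = 0
    · have hx : -x = ⟨-x.int, 0, IsMVChain.zero_ne_one⟩ := dif_pos h
      rw [hx]
      have h' : (0 : N) ⊕ₘ x.frac ≠ 1 := by
        rw [h]
        exact zero_oplus_zero_ne_one
      ext
      · change -x.int + x.int + carry 0 x.frac = 0
        rw [carry_of_ne h']
        ring
      · change remainder 0 x.frac = 0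
        rw [remainder_of_ne h', zero_oplus, h]
    · have hx : -x = ⟨-x.int - 1, ∼ₘ(x.frac), fun h1 => h (by
          rw [← neg_neg x.frac, h1, neg_one])⟩ := dif_neg h
      rw [hx]
      have h' := neg_oplus_self x.frac
      ext
      · change -x.int - 1 + x.int + carry ∼ₘ(x.frac) x.frac = 0
        rw [carry_of_eq h']
        ring
      · change remainder ∼ₘ(x.frac) x.frac = 0
        rw [remainder_of_eq h', otimes_eq_ominus, ominus_self]

instance : LE (ChangGroup N) :=
  ⟨fun x y => x.int < y.int ∨ x.int = y.int ∧ x.frac ≼ y.frac⟩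

theorem le_def {x y : ChangGroup N} :
    x ≤ y ↔ x.int < y.int ∨ x.int = y.int ∧ x.frac ≼ y.frac := Iff.rfl

open Classical in
noncomputable instance [IsMVChain N] : LinearOrder (ChangGroup N) where
  le_refl x := Or.inr ⟨rfl, MVAlgebra.le_refl _⟩
  le_trans x y z h h' := by
    rw [le_def] at *
    rcases h with h | ⟨h, h1⟩
    · left
      rcases h' with h' | ⟨h', -⟩ <;> linarith
    · rcases h' with h' | ⟨h', h1'⟩
      · left
        linarith
      · exact Or.inr ⟨h.trans h', MVAlgebra.le_trans h1 h1'⟩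
  le_antisymm x y h h' := by
    rw [le_def] at *
    rcases h with h | ⟨h, h1⟩
    · rcases h' with h' | ⟨h', -⟩ <;> linarith
    · rcases h' with h' | ⟨h', h1'⟩
      · linarith
      · exact ChangGroup.ext h (MVAlgebra.le_antisymm h1 h1')
  le_total x y := by
    rw [le_def, le_def]
    rcases lt_trichotomy x.int y.int with h | h | h
    · exact Or.inl (Or.inl h)
    · rcases IsMVChain.total x.frac y.frac with h1 | h1
      · exact Or.inl (Or.inr ⟨h, h1⟩)
      · exact Or.inr (Or.inr ⟨h.symm, h1⟩)
    · exact Or.inr (Or.inl h)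
  toDecidableLE := Classical.decRel _

instance [IsMVChain N] : IsOrderedAddMonoid (ChangGroup N) := by
  have key : ∀ x y : ChangGroup N, x ≤ y → ∀ z, z + x ≤ z + y := by
    intro x y h z
    rw [le_def] at h ⊢
    rw [int_add, int_add, frac_add, frac_add]
    by_cases hx : z.frac ⊕ₘ x.frac = 1 <;> by_cases hy : z.frac ⊕ₘ y.frac = 1
    · rw [carry_of_eq hx, carry_of_eq hy, remainder_of_eq hx, remainder_of_eq hy]
      rcases h with h | ⟨h, h1⟩
      · left
        linarith
      · right
        refine ⟨by rw [h], ?_⟩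
        rw [otimes_eq_ominus_neg, otimes_eq_ominus_neg]
        exact ominus_le_ominus h1 (MVAlgebra.le_refl _)
    · rw [carry_of_eq hx, carry_of_ne hy, remainder_of_eq hx, remainder_of_ne hy]
      rcases h with h | ⟨h, h1⟩
      -- When the integral parts differ by one, the carry on the left closes the gap, and the
      -- fractions decide: `z ⊗ x ≤ z ≤ z ⊕ y`.
      · rcases (Int.add_one_le_iff.2 h).lt_or_eq with h2 | h2
        · left
          linarith
        · right
          exact ⟨by linarith, MVAlgebra.le_trans (otimes_le_left _ _) (le_oplus_right _ _)⟩
      · refine absurd (eq_one_of_le ?_) hy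
        rw [← hx]
        exact oplus_le_oplus (MVAlgebra.le_refl _) h1
    · rw [carry_of_ne hx, carry_of_eq hy]
      left
      rcases h with h | ⟨h, h1⟩ <;> linarith
    · rw [carry_of_ne hx, carry_of_ne hy, remainder_of_ne hx, remainder_of_ne hy]
      rcases h with h | ⟨h, h1⟩
      · left
        linarith
      · right
        exact ⟨by rw [h], oplus_le_oplus (MVAlgebra.le_refl _) h1⟩
  refine { add_le_add_left := fun x y h z => ?_ }
  rw [add_comm x, add_comm y]
  exact key x y h z

instance [IsMVChain N] : ZeroLEOneClass (ChangGroup N) := ⟨Or.inl zero_lt_one⟩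

instance [IsMVChain N] : NeZero (1 : ChangGroup N) :=
  ⟨fun h => one_ne_zero (α := ℤ) (congrArg ChangGroup.int h)⟩

open Classical in
/-- The embedding of an MV-chain as the unit interval of its Chang group. -/
noncomputable def of [IsMVChain N] (a : N) : ChangGroup N :=
  if h : a = 1 then 1 else ⟨0, a, h⟩

theorem of_one [IsMVChain N] : of (1 : N) = 1 := dif_pos rfl

theorem of_ne_one [IsMVChain N] {a : N} (h : a ≠ 1) : of a = ⟨0, a, h⟩ := dif_neg h

theorem of_zero [IsMVChain N] : of (0 : N) = 0 := of_ne_one IsMVChain.zero_ne_one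

theorem of_nonneg [IsMVChain N] (a : N) : 0 ≤ of a := by
  by_cases h : a = 1
  · rw [h, of_one]
    exact zero_le_one
  · rw [of_ne_one h]
    exact Or.inr ⟨rfl, zero_le a⟩

theorem of_le_one [IsMVChain N] (a : N) : of a ≤ 1 := by
  by_cases h : a = 1
  · rw [h, of_one]
  · rw [of_ne_one h]
    exact Or.inl zero_lt_one

theorem of_injective [IsMVChain N] : Function.Injective (of : N → ChangGroup N) := by
  intro a b h
  by_cases ha : a = 1 <;> by_cases hb : b = 1
  · rw [ha, hb]
  · rw [ha, of_one, of_ne_one hb] at h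
    exact absurd (congrArg ChangGroup.int h) one_ne_zero
  · rw [hb, of_one, of_ne_one ha] at h
    exact absurd (congrArg ChangGroup.int h) (_root_.zero_ne_one (α := ℤ))
  · rw [of_ne_one ha, of_ne_one hb] at h
    exact congrArg ChangGroup.frac h

theorem of_add_of [IsMVChain N] {a b : N} (h : a ⊕ₘ b ≠ 1) : of a + of b = of (a ⊕ₘ b) := by
  have ha : a ≠ 1 := by
    rintro rfl
    exact h (one_oplus b)
  have hb : b ≠ 1 := by
    rintro rfl
    exact h (oplus_one a)
  rw [of_ne_one ha, of_ne_one hb, of_ne_one h]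
  ext
  · change 0 + 0 + carry a b = 0
    rw [carry_of_ne h]
    rfl
  · exact remainder_of_ne h

theorem one_le_of_add_of [IsMVChain N] {a b : N} (h : a ⊕ₘ b = 1) : 1 ≤ of a + of b := by
  by_cases ha : a = 1
  · rw [ha, of_one]
    exact le_add_of_nonneg_right (of_nonneg b)
  by_cases hb : b = 1
  · rw [hb, of_one]
    exact le_add_of_nonneg_left (of_nonneg a)
  rw [of_ne_one ha, of_ne_one hb]
  refine Or.inr ⟨?_, zero_le _⟩
  change 1 = 0 + 0 + carry a b
  rw [carry_of_eq h]
  rfl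

theorem of_add_of_neg [IsMVChain N] (a : N) : of a + of ∼ₘa = 1 := by
  by_cases ha : a = 1
  · rw [ha, neg_one, of_one, of_zero, add_zero]
  by_cases hb : ∼ₘa = 1
  · have h0 : a = 0 := by rw [← neg_neg a, hb, neg_one]
    rw [hb, h0, of_one, of_zero, zero_add]
  rw [of_ne_one ha, of_ne_one hb]
  have h := oplus_neg_self a
  ext
  · change 0 + 0 + carry a ∼ₘa = 1
    rw [carry_of_eq h]
    rfl
  · change remainder a ∼ₘa = 0
    rw [remainder_of_eq h, otimes_eq_ominus, neg_neg, ominus_self]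

theorem nsmul_one_eq [IsMVChain N] (n : ℕ) :
    n • (1 : ChangGroup N) = ⟨n, 0, IsMVChain.zero_ne_one⟩ := by
  induction n with
  | zero => rw [zero_nsmul]; rfl
  | succ n ih =>
    rw [succ_nsmul, ih]
    ext
    · change (n : ℤ) + 1 + carry (0 : N) 0 = ((n + 1 : ℕ) : ℤ)
      rw [carry_of_ne zero_oplus_zero_ne_one]
      push_cast
      ring
    · change remainder (0 : N) 0 = 0
      rw [remainder_of_ne zero_oplus_zero_ne_one, oplus_zero]

/-- Group multiples agree with those in the chain until the first sum reaching `1`; from then on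
they stay above the unit. -/
theorem one_le_nsmul_of_or [IsMVChain N] (a : N) (k : ℕ) :
    1 ≤ k • of a ∨ k • of a = of (multiple k a) := by
  induction k with
  | zero =>
    right
    rw [zero_nsmul]
    exact of_zero.symm
  | succ k ih =>
    rw [succ_nsmul']
    rcases ih with ih | ih
    · exact Or.inl (ih.trans (le_add_of_nonneg_left (of_nonneg a)))
    · rw [ih]
      by_cases h : a ⊕ₘ multiple k a = 1
      · exact Or.inl (one_le_of_add_of h)
      · exact Or.inr (of_add_of h)

theorem archimedean [IsMVChain N] (hN : AllFiniteOrder N) : Archimedean (ChangGroup N) := by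
  refine ⟨fun x y hy => ?_⟩
  -- It suffices to reach the unit. One copy of `y` does so if its integral part is positive;
  -- otherwise `y` is a fraction, of finite order in the chain.
  have h1 : ∃ k : ℕ, 1 ≤ k • y := by
    rcases le_def.1 hy.le with h | ⟨h, -⟩
    · refine ⟨1, ?_⟩
      rw [one_nsmul]
      rcases (Int.add_one_le_iff.2 h).lt_or_eq with h2 | h2
      · exact Or.inl h2
      · exact Or.inr ⟨h2, zero_le _⟩
    · have hof : y = of y.frac := by
        rw [of_ne_one y.frac_ne_one]
        exact ChangGroup.ext h.symm rfl
      have hne : y.frac ≠ 0 := by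
        intro h0
        rw [h0, of_zero] at hof
        exact hy.ne' hof
      obtain ⟨k, -, hk⟩ := hN _ hne
      refine ⟨k, ?_⟩
      rcases one_le_nsmul_of_or y.frac k with h2 | h2
      · rwa [← hof] at h2
      · rw [← hof, hk, of_one] at h2
        exact h2.ge
  obtain ⟨k, hk⟩ := h1
  refine ⟨(x.int.natAbs + 1) * k, ?_⟩
  rw [mul_nsmul']
  refine _root_.le_trans ?_ (nsmul_le_nsmul_right hk _)
  rw [nsmul_one_eq]
  left
  push_cast
  have := le_abs_self x.int
  linarith

end ChangGroup

/-- A nontrivial MV-algebra in which every nonzero element has finite order embeds in `[0, 1]`. -/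
theorem AllFiniteOrder.exists_injective_hom (h0 : (0 : N) ≠ 1) (h : AllFiniteOrder N) :
    ∃ f : Hom N unitInterval, Function.Injective f.toFun := by
  have : IsMVChain N := ⟨h.isTotallyOrdered, h0⟩
  have := ChangGroup.archimedean h
  -- Hölder's embedding, normalised to send the unit to 1. Truncated sums match because `a ⊕ b = 1`
  -- means that the group sum reaches the unit.
  let φ : ChangGroup N →+o ℝ := Archimedean.embedReal (ChangGroup N)
  have hφ1 : φ 1 = 1 := Archimedean.embedReal_one
  have hinj : Function.Injective φ := Archimedean.embedReal_injective (ChangGroup N)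
  have hmono : Monotone φ := φ.monotone'
  let f : N → unitInterval := fun a => ⟨φ (.of a), by
    rw [← map_zero φ]
    exact hmono (ChangGroup.of_nonneg a), by
    rw [← hφ1]
    exact hmono (ChangGroup.of_le_one a)⟩
  refine ⟨.ofOplusNeg f (fun a b => ?_) (fun a => ?_) ?_, fun a b hab => ?_⟩
  · apply Subtype.ext
    change φ (.of (a ⊕ₘ b)) = min (φ (.of a) + φ (.of b)) 1
    rw [← map_add]
    by_cases hab : a ⊕ₘ b = 1
    · rw [hab, ChangGroup.of_one, hφ1, min_eq_right]
      rw [← hφ1]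
      exact hmono (ChangGroup.one_le_of_add_of hab)
    · rw [ChangGroup.of_add_of hab, min_eq_left]
      rw [← hφ1]
      exact hmono (ChangGroup.of_le_one _)
  · apply Subtype.ext
    change φ (.of ∼ₘa) = 1 - φ (.of a)
    rw [← hφ1, ← ChangGroup.of_add_of_neg a, map_add]
    ring
  · apply Subtype.ext
    change φ (.of 0) = 0
    rw [ChangGroup.of_zero, map_zero]
  · exact ChangGroup.of_injective (hinj (Subtype.ext_iff.1 hab))

theorem IsMaximalIdeal.exists_hom {M : Set N} (hM : IsMaximalIdeal M) :
    ∃ f : Hom N unitInterval, ∀ a, f.toFun a = 0 ↔ a ∈ M := by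
  obtain ⟨g, hg⟩ := hM.allFiniteOrder_quotient.exists_injective_hom hM.zero_ne_one_quotient
  refine ⟨g.comp (IdealQuotient.mkHom hM.1.1), fun a => ?_⟩
  rw [← IdealQuotient.mk_eq_zero_iff hM.1.1, ← hg.eq_iff, g.map_zero]
  rfl

end ChangGroup

/-! ### Powers of the unit interval; counterexamples -/

section Cubes

theorem unitInterval_le_iff {x y : unitInterval} : x ≼ y ↔ x ≤ y := by
  rw [le_iff, ← Subtype.coe_inj]
  change min (1 - (x : ℝ) + y) 1 = 1 ↔ (x : ℝ) ≤ y
  rw [min_eq_right_iff]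
  constructor <;> intro h <;> linarith

theorem unitInterval_coe_multiple (n : ℕ) (x : unitInterval) :
    ((multiple n x : unitInterval) : ℝ) = min ((n : ℝ) * x) 1 := by
  induction n with
  | zero =>
    rw [Nat.cast_zero, zero_mul, min_eq_left zero_le_one]
    rfl
  | succ n ih =>
    change min ((x : ℝ) + multiple n x) 1 = _
    rw [ih]
    have := x.2.1
    push_cast
    rcases min_cases ((n : ℝ) * x) 1 with h | h
    · rw [h.1]
      ring_nf
    · rw [h.1, min_eq_right (by linarith), min_eq_right (by linarith)]

theorem unitInterval_allFiniteOrder : AllFiniteOrder unitInterval := by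
  intro x hx
  have hpos : (0 : ℝ) < x := _root_.lt_of_le_of_ne x.2.1 fun h => hx (Subtype.ext h.symm)
  obtain ⟨n, hn⟩ := Archimedean.arch (1 : ℝ) hpos
  rw [nsmul_eq_mul] at hn
  refine ⟨n + 1, Nat.le_add_left _ _, Subtype.ext ?_⟩
  rw [unitInterval_coe_multiple]
  apply min_eq_right
  push_cast
  linarith

theorem pi_le_iff {ι : Type u} {A : ι → Type v} [∀ i, MVAlgebra (A i)] {f g : ∀ i, A i} :
    f ≼ g ↔ ∀ i, f i ≼ g i := funext_iff

theorem pi_multiple_apply {ι : Type u} {A : ι → Type v} [∀ i, MVAlgebra (A i)] (f : ∀ i, A i)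
    (n : ℕ) (i : ι) : multiple n f i = multiple n (f i) := by
  induction n with
  | zero => rfl
  | succ n ih => exact congrArg (oplus (f i)) ih

theorem pi_isComplemented_iff {ι : Type u} {A : ι → Type v} [∀ i, MVAlgebra (A i)]
    {f : ∀ i, A i} : IsComplemented f ↔ ∀ i, IsComplemented (f i) := funext_iff

theorem cube_le_iff {ι : Type u} {f g : ι → unitInterval} : f ≼ g ↔ f ≤ g :=
  pi_le_iff.trans (forall_congr' fun _ => unitInterval_le_iff)

theorem cube_isCompleteLattice (ι : Type u) : IsCompleteLattice (ι → unitInterval) := by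
  intro S
  simp only [cube_le_iff]
  exact ⟨⟨sSup S, fun a => le_sSup, fun b => sSup_le⟩, sInf S, fun a => sInf_le, fun b => le_sInf⟩

theorem cube_isSemisimple (ι : Type u) : IsSemisimple (ι → unitInterval) :=
  isSemisimple_of_archimedean fun _ => (cube_isCompleteLattice ι).eq_zero_of_forall_multiple_le

theorem cube_nontrivial (ι : Type u) [Nonempty ι] : Nontrivial (ι → unitInterval) :=
  inferInstance

/-- In each coordinate the multiples are eventually constant, `0` or `1`; finitely many thresholds
have a common bound. -/
theorem cube_isHyperarchimedean (ι : Type u) [Finite ι] :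
    IsHyperarchimedean (ι → unitInterval) := by
  apply HasComplementedMultiples.isHyperarchimedean
  intro a
  have h : ∀ i, ∃ n : ℕ, ∀ m, n ≤ m → IsComplemented (multiple m (a i)) := by
    intro i
    by_cases h0 : a i = 0
    · refine ⟨0, fun m _ => ?_⟩
      rw [h0, multiple_zero_right, isComplemented_iff]
      exact eq_zero_of_le (wedge_le_left _ _)
    · obtain ⟨n, -, hn⟩ := unitInterval_allFiniteOrder _ h0
      refine ⟨n, fun m hm => ?_⟩
      have h1 : multiple m (a i) = 1 := eq_one_of_le (hn ▸ multiple_mono hm (a i))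
      rw [h1, isComplemented_iff, neg_one]
      exact eq_zero_of_le (wedge_le_right _ _)
  choose n hn using h
  obtain ⟨m, hm⟩ := (Set.finite_range n).bddAbove
  refine ⟨m + 1, Nat.le_add_left _ _, pi_isComplemented_iff.2 fun i => ?_⟩
  rw [pi_multiple_apply]
  exact hn i _ ((hm ⟨i, rfl⟩).trans (Nat.le_succ m))

/-- An element supported at one coordinate keeps the value `0` elsewhere in all its multiples. -/
theorem cube_not_isSimple {ι : Type u} [Nontrivial ι] : ¬ IsSimple (ι → unitInterval) := by
  classical
  intro h
  obtain ⟨i, j, hij⟩ := exists_pair_ne ι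
  have h01 : (1 : unitInterval) ≠ 0 := one_ne_zero
  obtain ⟨k, -, hk⟩ := h.allFiniteOrder (Pi.single i 1 : ι → unitInterval) fun h0 => by
    have := congrFun h0 i
    rw [Pi.single_eq_same] at this
    exact h01 this
  have h1 := congrFun hk j
  rw [pi_multiple_apply, Pi.single_eq_of_ne hij.symm] at h1
  exact h01 (h1.symm.trans (multiple_zero_right k))

theorem cube_not_isHyperarchimedean {ι : Type u} [Infinite ι] :
    ¬ IsHyperarchimedean (ι → unitInterval) := by
  intro h
  obtain ⟨g, hg⟩ : ∃ g : ι → ℕ, Function.Surjective g :=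
    ⟨_, Function.invFun_surjective (Infinite.natEmbedding ι).injective⟩
  -- Where `g i = n`, the multiple `n a` takes the value n / (2n + 1), strictly between 0 and 1/2,
  -- hence not complemented. Surjectivity of `g` defeats every `n ≥ 1`.
  let a : ι → unitInterval := fun i => ⟨1 / (2 * g i + 1), by positivity, by
    rw [div_le_one (by positivity)]
    have : (0 : ℝ) ≤ g i := Nat.cast_nonneg _
    linarith⟩
  obtain ⟨n, hn, hc⟩ := h.primeEqMaximal.hasComplementedMultiples a
  obtain ⟨i, hi⟩ := hg n
  have h1 := pi_isComplemented_iff.1 hc i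
  rw [pi_multiple_apply, isComplemented_iff] at h1
  have hn1 : (1 : ℝ) ≤ n := by exact_mod_cast hn
  have hx : ((multiple n (a i) : unitInterval) : ℝ) = n / (2 * n + 1) := by
    rw [unitInterval_coe_multiple]
    change min ((n : ℝ) * (1 / (2 * g i + 1))) 1 = _
    rw [hi, mul_one_div, min_eq_left]
    rw [div_le_one (by positivity)]
    linarith
  have hhalf : (n : ℝ) / (2 * n + 1) ≤ 1 / 2 := by
    rw [div_le_div_iff₀ (by positivity) (by positivity)]
    linarith
  have hle : multiple n (a i) ≼ ∼ₘ(multiple n (a i)) := by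
    rw [unitInterval_le_iff]
    change ((multiple n (a i) : unitInterval) : ℝ) ≤ 1 - ((multiple n (a i) : unitInterval) : ℝ)
    rw [hx]
    linarith
  rw [wedge_eq_left hle] at h1
  have h2 : ((multiple n (a i) : unitInterval) : ℝ) = 0 := congrArg Subtype.val h1
  rw [hx] at h2
  have : (0 : ℝ) < n / (2 * n + 1) := by positivity
  linarith

end Cubes

/-! ### Representation theorems and the equivalences -/

section Representation

variable {N : Type u} [MVAlgebra N]

theorem IsSubalgebraOfUnitInterval.allFiniteOrder (h : IsSubalgebraOfUnitInterval N) :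
    AllFiniteOrder N := by
  obtain ⟨S, hS⟩ := h
  obtain ⟨f, hf⟩ := hS.exists_injective_hom
  intro a ha
  obtain ⟨k, hk, hk1⟩ := unitInterval_allFiniteOrder (f.toFun a) fun h0 =>
    ha (hf (h0.trans f.map_zero.symm))
  exact ⟨k, hk, hf (by rw [f.map_multiple, hk1, f.map_one])⟩

theorem AllFiniteOrder.isSubalgebraOfUnitInterval (h0 : (0 : N) ≠ 1) (h : AllFiniteOrder N) :
    IsSubalgebraOfUnitInterval N := by
  obtain ⟨f, hf⟩ := h.exists_injective_hom h0
  exact ⟨f.range, f.isomorphic_range hf⟩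

/-- Each maximal ideal is the kernel of a map to [0, 1]; the common kernel of these maps is `Rad
{0}`. -/
theorem IsSemisimple.isSubdirectProduct (h : IsSemisimple N) : IsSubdirectProduct N := by
  choose f hf using fun M : {M : Set N // IsMaximalIdeal M} => M.2.exists_hom
  refine ⟨{M : Set N // IsMaximalIdeal M}, fun M => (f M).range,
    .ofOplusNeg (fun a M => ⟨(f M).toFun a, a, rfl⟩)
      (fun a b => funext fun M => Subtype.ext ((f M).map_oplus a b))
      (fun a => funext fun M => Subtype.ext ((f M).map_neg a))
      (funext fun M => Subtype.ext (f M).map_zero), ?_, ?_⟩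
  · apply Hom.injective_of_forall_eq_zero
    intro a ha
    have h1 : a ∈ Rad ({0} : Set N) := fun M hM _ =>
      (hf ⟨M, hM⟩ a).1 (congrArg Subtype.val (congrFun ha ⟨M, hM⟩))
    rwa [show Rad ({0} : Set N) = {0} from h] at h1
  · rintro M ⟨_, a, rfl⟩
    exact ⟨a, rfl⟩

theorem IsSubdirectProduct.isSubalgebraOfComplete (h : IsSubdirectProduct N) :
    IsSubalgebraOfComplete N := by
  obtain ⟨ι, S, f, hf, -⟩ := h
  let g : Hom (∀ i, (S i).carrier) (ι → unitInterval) :=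
    .ofOplusNeg (fun x i => (x i).1) (fun _ _ => rfl) (fun _ => rfl) rfl
  have hg : Function.Injective g.toFun := fun x y hxy =>
    funext fun i => Subtype.ext (congrFun hxy i)
  exact ⟨ι → unitInterval, inferInstance, cube_isCompleteLattice ι, (g.comp f).range,
    (g.comp f).isomorphic_range (hg.comp hf)⟩

/-- Semisimplicity is tested by `n a ≤ ¬a` for all `n`, a condition that the embedding carries into
the complete algebra, where only `0` satisfies it. -/
theorem IsSubalgebraOfComplete.isSemisimple (h : IsSubalgebraOfComplete N) :
    IsSemisimple N := by
  obtain ⟨M, _, hM, S, hS⟩ := h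
  obtain ⟨f, hf⟩ := hS.exists_injective_hom
  refine isSemisimple_of_archimedean fun a ha => hf ?_
  rw [f.map_zero]
  refine hM.eq_zero_of_forall_multiple_le fun n => ?_
  rw [← f.map_multiple, ← f.map_neg]
  exact f.map_le (ha n)

theorem simple_tfae (h0 : (0 : N) ≠ 1) :
    [IsSimple N, AllFiniteOrder N, IsSubalgebraOfUnitInterval N].TFAE := by
  tfae_have 1 → 2 := IsSimple.allFiniteOrder
  tfae_have 2 → 1 := AllFiniteOrder.isSimple h0
  tfae_have 2 → 3 := AllFiniteOrder.isSubalgebraOfUnitInterval h0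
  tfae_have 3 → 2 := IsSubalgebraOfUnitInterval.allFiniteOrder
  tfae_finish

variable (N) in
theorem hyperarchimedean_tfae :
    [IsHyperarchimedean N, PrimeEqMaximal N, HasComplementedMultiples N].TFAE := by
  tfae_have 1 → 2 := IsHyperarchimedean.primeEqMaximal
  tfae_have 2 → 3 := PrimeEqMaximal.hasComplementedMultiples
  tfae_have 3 → 1 := HasComplementedMultiples.isHyperarchimedean
  tfae_finish

variable (N) in
theorem semisimple_tfae :
    [IsSemisimple N, IsSubdirectProduct N, IsSubalgebraOfComplete N].TFAE := by
  tfae_have 1 → 2 := IsSemisimple.isSubdirectProduct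
  tfae_have 2 → 3 := IsSubdirectProduct.isSubalgebraOfComplete
  tfae_have 3 → 1 := IsSubalgebraOfComplete.isSemisimple
  tfae_finish

theorem chain_tfae (h0 : (0 : N) ≠ 1) (hN : IsTotallyOrdered N) :
    [IsSimple N, AllFiniteOrder N, IsSubalgebraOfUnitInterval N, IsHyperarchimedean N,
      PrimeEqMaximal N, HasComplementedMultiples N, IsSemisimple N, IsSubdirectProduct N,
      IsSubalgebraOfComplete N].TFAE := by
  tfae_have 1 ↔ 2 := (simple_tfae h0).out 0 1
  tfae_have 1 ↔ 3 := (simple_tfae h0).out 0 2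
  tfae_have 4 ↔ 5 := (hyperarchimedean_tfae N).out 0 1
  tfae_have 4 ↔ 6 := (hyperarchimedean_tfae N).out 0 2
  tfae_have 7 ↔ 8 := (semisimple_tfae N).out 0 1
  tfae_have 7 ↔ 9 := (semisimple_tfae N).out 0 2
  tfae_have 1 → 4 := IsSimple.isHyperarchimedean
  tfae_have 4 → 7 := IsHyperarchimedean.isSemisimple
  tfae_have 7 → 2 := IsSemisimple.allFiniteOrder hN
  tfae_finish

end Representation

end MVAlgebra

theorem theorem3p2p3 (N : Type u) [MVAlgebra N] :
    -- the conditions on a nontrivial `N` equivalent to simplicity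
    (Nontrivial N →
      [MVAlgebra.IsSimple N,
        MVAlgebra.AllFiniteOrder N,
        MVAlgebra.IsSubalgebraOfUnitInterval N].TFAE) ∧
    -- the conditions equivalent to being hyperarchimedean
    [MVAlgebra.IsHyperarchimedean N,
      MVAlgebra.PrimeEqMaximal N,
      MVAlgebra.HasComplementedMultiples N].TFAE ∧
    -- the conditions equivalent to semisimplicity
    [MVAlgebra.IsSemisimple N,
      MVAlgebra.IsSubdirectProduct N,
      MVAlgebra.IsSubalgebraOfComplete N].TFAE ∧
    -- the implications between the three classes, and their strictness
    ((MVAlgebra.IsSimple N → MVAlgebra.IsHyperarchimedean N) ∧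
      (MVAlgebra.IsHyperarchimedean N → MVAlgebra.IsSemisimple N) ∧
      (∃ (M : Type u) (_ : MVAlgebra M), Nontrivial M ∧
        MVAlgebra.IsHyperarchimedean M ∧ ¬ MVAlgebra.IsSimple M) ∧
      (∃ (M : Type u) (_ : MVAlgebra M), Nontrivial M ∧
        MVAlgebra.IsSemisimple M ∧ ¬ MVAlgebra.IsHyperarchimedean M)) ∧
    -- the totally ordered case
    (Nontrivial N → MVAlgebra.IsTotallyOrdered N →
      [MVAlgebra.IsSimple N,
        MVAlgebra.AllFiniteOrder N,
        MVAlgebra.IsSubalgebraOfUnitInterval N,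
        MVAlgebra.IsHyperarchimedean N,
        MVAlgebra.PrimeEqMaximal N,
        MVAlgebra.HasComplementedMultiples N,
        MVAlgebra.IsSemisimple N,
        MVAlgebra.IsSubdirectProduct N,
        MVAlgebra.IsSubalgebraOfComplete N].TFAE) := by
  refine ⟨fun _ => MVAlgebra.simple_tfae MVAlgebra.zero_ne_one, MVAlgebra.hyperarchimedean_tfae N,
    MVAlgebra.semisimple_tfae N, ⟨MVAlgebra.IsSimple.isHyperarchimedean,
      MVAlgebra.IsHyperarchimedean.isSemisimple,
      -- The square, then the countable power; `ULift` only places the index sets in the right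
      -- universe.
      ⟨ULift.{u} Bool → unitInterval, inferInstance, MVAlgebra.cube_nontrivial _,
        MVAlgebra.cube_isHyperarchimedean _, MVAlgebra.cube_not_isSimple⟩,
      ⟨ULift.{u} ℕ → unitInterval, inferInstance, MVAlgebra.cube_nontrivial _,
        MVAlgebra.cube_isSemisimple _, MVAlgebra.cube_not_isHyperarchimedean⟩⟩,
    fun _ => MVAlgebra.chain_tfae MVAlgebra.zero_ne_one⟩
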